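/- Let $n=2^{r}n'$ with $r\ge 0$, $n'\ge 1$ odd, and let $k\ge 1$. **Cayley maps.** For a finite abelian group $G$ (written additively), a set of generators $\Omega$ of $G$ with $0\notin\Omega=-\Omega$, and a cyclic permutation $\rho$ of $\Omega$, the Cayley map $\mathcal{CM}(G,\Omega,\rho)$ is the Cayley graph $\mathrm{Cay}(G,\Omega)$, with arcs $(\eta,\omega)\in G\times\Omega$ from $\eta$ to $\eta+\omega$, together with the rotation $\tilde\rho(\eta,\omega)=(\eta,\rho(\omega))$ of its arcs. An isomorphism of Cayley maps is an isomorphism of the Cayley graphs whose induced function on arcs commutes with the rotations. The map is regular if every arc can be sent to every other arc by an automorphism, and balanced if $\rho(-\omega)=-\rho(\omega)$ for all $\omega\in\Omega$; RBCM means regular balanced Cayley map. It is $2n$-valent of type I if $|\Omega|=2n$, $\Omega=\{\pm\omega_1,\ldots,\pm\omega_n\}$, $\rho(\pm\omega_i)=\pm\omega_{i+1}$ for $1\le i<n$ and $\rho(\pm\omega_n)=\mp\omega_1$. **Polynomials.** For odd $d\ge1$ let $o(2,d)$ be the order of $2$ in $(\mathbb{Z}/d)^{\times}$, let $\Xi(2,d)$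 be a set of representatives of the cosets of $\langle 2\rangle$ in $(\mathbb{Z}/d)^{\times}$, and let $\eta_d$ be a primitive $d$-th root of unity in $\overline{\mathbb{F}_2}$. Let $\Lambda(2,n')=\{(d,\ell):d\mid n',\ \ell\in\Xi(2,d)\}$. For $\lambda=(d,\ell)\in\Lambda(2,n')$ let $q_\lambda=\prod_{j=0}^{o(2,d)-1}(x-\eta_d^{\ell 2^j})\in\mathbb{F}_2[x]$, let $q^{(k)}_\lambda\in\mathbb{Z}_{2^k}[x]$ be the unique monic factor of $x^{n'}-1$ that reduces to $q_\lambda$ modulo $2$, and let $q^{(k)}_{\lambda,r+1}\in\mathbb{Z}_{2^k}[x]$ be the unique monic factor of $x^{n}+1$ that reduces to $q_\lambda^{2^r}$ modulo $2$. Here $\mathbb{Z}_{2^k}=\mathbb{Z}/2^k\mathbb{Z}$. **The maps.** For functions $J:\Lambda(2,n')\to\{0,\ldots,k-1\}$ and $K:\Lambda(2,n')\to\{0,\ldots,2^r\}$ let $$G_{J,K}=\prod_{\lambda\in\Lambda(2,n')}\mathbb{Z}_{2^k}[x]\big/\big(q^{(k)}_{\lambda,r+1},\,2^{J(\lambda)}(q^{(k)}_\lambda)^{K(\lambda)},\,2^{J(\lambda)+1}\big),$$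 let $\omega_{J,K;i}$ be the image of $x^{i-1}$ in $G_{J,K}$, let $\Omega_{J,K}=\{\pm\omega_{J,K;i}:1\le i\le n\}$, and let $\rho_{J,K}$ be given by $\rho_{J,K}(\pm\omega_{J,K;i})=\pm\omega_{J,K;i+1}$ for $1\le i<n$ and $\rho_{J,K}(\pm\omega_{J,K;n})=\mp\omega_{J,K;1}$ (that is, by multiplication by $x$). **Theorem.** Every $2n$-valent type I RBCM on an abelian $2$-group of exponent $2^k$ is isomorphic to $\mathcal{CM}(G_{J,K},\Omega_{J,K},\rho_{J,K})$ for a unique pair of functions $J:\Lambda(2,n')\to\{0,\ldots,k-1\}$, $K:\Lambda(2,n')\to\{0,\ldots,2^r\}$ such that $J(\lambda)=k-1$ and $K(\lambda)\ne0$ for some $\lambda\in\Lambda(2,n')$, and $J(\lambda)=0$ for every $\lambda\in\Lambda(2,n')$ with $K(\lambda)=0$. In particular, for this pair, $\mathcal{CM}(G_{J,K},\Omega_{J,K},\rho_{J,K})$ is a Cayley map and is $2n$-valent of type I with respect to $\omega_{J,K;1},\ldots,\omega_{J,K;n}$. -/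

import Mathlib

open Polynomial

/-! ### Cayley maps on (additively written) abelian groups -/

/-- The data `(Ω, ρ)` of a Cayley map `CM(G, Ω, ρ)`: a connection set `Ω` and a rotation `ρ`
(only the values of `ρ` on `Ω` are ever used). -/
structure CayleyData (G : Type*) where
  Ω : Set G
  ρ : G → G

namespace CayleyData

variable {G H : Type*} [AddCommGroup G] [AddCommGroup H]

/-- `(Ω, ρ)` defines a Cayley map on `G`: `G` is finite, `Ω` is a set of generators of `G` which is
closed under inverses and does not contain the neutral element, and `ρ` restricts to a cyclic
permutation of `Ω`. -/
structure IsCayleyMap (M : CayleyData G) : Prop where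
  finite : Finite G
  zero_notMem : (0 : G) ∉ M.Ω
  neg_mem : ∀ ω ∈ M.Ω, -ω ∈ M.Ω
  generates : AddSubgroup.closure M.Ω = ⊤
  bijOn : Set.BijOn M.ρ M.Ω M.Ω
  cyclic : ∀ a ∈ M.Ω, ∀ b ∈ M.Ω, ∃ m : ℕ, M.ρ^[m] a = b

/-- An isomorphism of Cayley maps: a bijection `φ` of the vertices which is an isomorphism of the
Cayley graphs (`η → η + ω` is an arc, for `ω ∈ Ω`, iff its image is one) and whose induced function
on arcs, `(η, ω) ↦ (φ η, φ (η + ω) - φ η)`, commutes with the rotations `(η, ω) ↦ (η, ρ ω)`. -/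
structure Iso (M : CayleyData G) (N : CayleyData H) extends G ≃ H where
  arc_iff : ∀ η ω : G, ω ∈ M.Ω ↔ toFun (η + ω) - toFun η ∈ N.Ω
  rot : ∀ η : G, ∀ ω ∈ M.Ω,
    toFun (η + M.ρ ω) - toFun η = N.ρ (toFun (η + ω) - toFun η)

/-- Any arc can be sent to any other arc by an automorphism of the map. -/
def IsRegular (M : CayleyData G) : Prop :=
  ∀ η η' : G, ∀ ω ∈ M.Ω, ∀ ω' ∈ M.Ω,
    ∃ φ : Iso M M, φ.toEquiv η = η' ∧ φ.toEquiv (η + ω) = η' + ω'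

/-- `ρ (ω⁻¹) = (ρ ω)⁻¹` on `Ω`. -/
def IsBalanced (M : CayleyData G) : Prop :=
  ∀ ω ∈ M.Ω, M.ρ (-ω) = -M.ρ ω

/-- `M` is `2n`-valent, with connection set `{±ω 0, …, ±ω (n-1)}`, and its rotation is
`±ω 0 ↦ ±ω 1 ↦ ⋯ ↦ ±ω (n-1) ↦ ∓ω 0`. -/
structure IsTypeIWith (M : CayleyData G) (n : ℕ) (ω : ℕ → G) : Prop where
  valency : M.Ω.ncard = 2 * n
  set_eq : M.Ω = {g | ∃ i < n, g = ω i ∨ g = -ω i}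
  step : ∀ i, i + 1 < n → M.ρ (ω i) = ω (i + 1) ∧ M.ρ (-ω i) = -ω (i + 1)
  last : M.ρ (ω (n - 1)) = -ω 0 ∧ M.ρ (-ω (n - 1)) = ω 0

/-- `M` is a `2n`-valent regular balanced Cayley map of type I. -/
structure IsTypeIRBCM (M : CayleyData G) (n : ℕ) : Prop where
  isCayleyMap : M.IsCayleyMap
  regular : M.IsRegular
  balanced : M.IsBalanced
  typeI : ∃ ω : ℕ → G, M.IsTypeIWith n ω

end CayleyData

/-! ### The index set `Λ(2, n')` and the polynomials attached to its elements -/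

/-- The subgroup `⟨2⟩` of `(ℤ/d)ˣ` (for odd `d`). -/
def twoPowers (d : ℕ) : Subgroup (ZMod d)ˣ :=
  Subgroup.closure {u | (u : ZMod d) = 2}

/-- `Λ(2, n')`: the pairs `(d, ℓ)` with `d ∣ n'` and `ℓ` a coset of `⟨2⟩` in `(ℤ/d)ˣ`; the coset
stands for its chosen representative `Quotient.out ℓ`. -/
def Lam (n' : ℕ) : Type :=
  Σ d : {d : ℕ // d ∈ n'.divisors}, (ZMod (d : ℕ))ˣ ⧸ twoPowers (d : ℕ)

noncomputable section

/-- An algebraic closure of the field with two elements. -/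
abbrev F2bar : Type := AlgebraicClosure (ZMod 2)

/-- `q_{d,ℓ} = ∏_{0 ≤ j < o(2,d)} (x - η_d ^ (ℓ 2^j))`, where `o(2,d)` is the order of `2` modulo `d`
and `η d` is a primitive `d`-th root of unity. -/
def qRed (η : ℕ → F2bar) {n' : ℕ} (l : Lam n') : F2bar[X] :=
  ∏ j ∈ Finset.range (orderOf (2 : ZMod (l.1 : ℕ))),
    (X - C (η l.1 ^ (((Quotient.out l.2 : (ZMod (l.1 : ℕ))ˣ) : ZMod (l.1 : ℕ)).val * 2 ^ j)))

/-- Reduction modulo `2`, followed by the inclusion of the field with two elements in its algebraic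
closure. -/
def red (k : ℕ) [NeZero k] : ZMod (2 ^ k) →+* F2bar :=
  (algebraMap (ZMod 2) F2bar).comp (ZMod.castHom (dvd_pow_self 2 (NeZero.ne k)) (ZMod 2))

/-- `q_λ^{(k)}`: the monic factor of `x^{n'} - 1` over `ℤ/2^k` that reduces to `q_λ` modulo `2`. For
odd `n'` it exists, is unique and irreducible, by Hensel lifting. -/
def qLift (η : ℕ → F2bar) (k : ℕ) [NeZero k] {n' : ℕ} (l : Lam n') : (ZMod (2 ^ k))[X] :=
  Classical.epsilon fun f =>
    f.Monic ∧ f ∣ X ^ n' - 1 ∧ f.map (red k) = qRed η l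

/-- `q_{λ,r+1}^{(k)}`: the monic factor of `1 + x^{2^r n'}` over `ℤ/2^k` that reduces to
`q_λ ^ (2^r)` modulo `2`. For odd `n'` it exists and is unique, by Hensel lifting, and it is
irreducible if `k ≥ 2`. -/
def qTop (η : ℕ → F2bar) (k r : ℕ) [NeZero k] {n' : ℕ} (l : Lam n') : (ZMod (2 ^ k))[X] :=
  Classical.epsilon fun f =>
    f.Monic ∧ f ∣ X ^ (2 ^ r * n') + 1 ∧ f.map (red k) = qRed η l ^ 2 ^ r

/-! ### The maps `CM(G_{J,K}, Ω_{J,K}, ρ_{J,K})` -/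

section Target

variable (η : ℕ → F2bar) (k r : ℕ) [NeZero k] {n' : ℕ}
  (J : Lam n' → Fin k) (K : Lam n' → Fin (2 ^ r + 1))

/-- The ideal `(q_{λ,r+1}^{(k)}, 2^{J(λ)} (q_λ^{(k)})^{K(λ)}, 2^{J(λ)+1})`. -/
def idealJK (l : Lam n') : Ideal (ZMod (2 ^ k))[X] :=
  Ideal.span {qTop η k r l, 2 ^ (J l : ℕ) * qLift η k l ^ (K l : ℕ), 2 ^ ((J l : ℕ) + 1)}

/-- `G_{J,K}`. -/
abbrev GJK : Type :=
  (l : Lam n') → (ZMod (2 ^ k))[X] ⧸ idealJK η k r J K l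

/-- The image of `x ^ i` in `G_{J,K}`; this is `ω_{J,K;i+1}`. -/
def omegaJK (i : ℕ) : GJK η k r J K :=
  fun l => Ideal.Quotient.mk (idealJK η k r J K l) (X ^ i)

/-- `Ω_{J,K} = {±1, ±x, …, ±x^{n-1}}` with `n = 2^r n'`. Since `x ^ n = -1` in `G_{J,K}`, the
rotation `±1 ↦ ±x ↦ ⋯ ↦ ±x^{n-1} ↦ ∓1` is multiplication by `x`. -/
def mapJK : CayleyData (GJK η k r J K) where
  Ω := {g | ∃ i < 2 ^ r * n', g = omegaJK η k r J K i ∨ g = -omegaJK η k r J K i}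
  ρ := fun g => omegaJK η k r J K 1 * g

end Target

/-- The parameters: `J(λ) = k - 1` and `K(λ) ≠ 0` for some `λ`, and `J(λ) = 0` whenever
`K(λ) = 0`. -/
structure IsAdmissible {n' k r : ℕ} (J : Lam n' → Fin k) (K : Lam n' → Fin (2 ^ r + 1)) : Prop where
  exists_top : ∃ l, (J l : ℕ) + 1 = k ∧ (K l : ℕ) ≠ 0
  normalized : ∀ l, (K l : ℕ) = 0 → (J l : ℕ) = 0

end

/-! For a balanced map of type I, ρ^n is negation on Ω, and this forces isomorphisms between such
maps to be affine. Applied to an automorphism supplied by regularity, it shows that ρ extends to an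
endomorphism of G. So G is a cyclic module over A = ℤ/2^k[x], generated by ω 0, with x acting as ρ,
and G ≅ A/I where I is the annihilator of ω 0. Here x^n + 1 ∈ I, and exponent exactly 2^k gives
2^(k-1) ∉ I. An isomorphism onto a target map respects x and sends ω 0 to a unit, so I is an
invariant (`polyAnnihilator_eq_of_iso`). It remains to classify the ideals I.

The polynomials T_λ = `qTop` are pairwise coprime with product x^n + 1, so I is the intersection of
the ideals I + (T_λ). Each A/(T_λ) is a chain ring: if π is the class of `qLift`, then 2 is
associated to π^(2^r) (`associated_two_mk_qLift_pow`), and every element is a unit or a multiple of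
π. Its ideals are the (π^e) with 0 ≤ e ≤ 2^r k, all distinct. Writing e = 2^r J + K gives the ideals
`idealJK`. The ambiguity between K = 0 and K = 2^r is removed by allowing K = 0 only for e = 0, and
2^(k-1) ∉ I says that some e exceeds 2^r (k-1), that is J = k-1 and K ≠ 0. -/

namespace CayleyData

variable {G H : Type*} [AddCommGroup G] [AddCommGroup H]

theorem IsCayleyMap.iterate_mem {M : CayleyData G} (hM : M.IsCayleyMap) (m : ℕ) {a : G}
    (ha : a ∈ M.Ω) : M.ρ^[m] a ∈ M.Ω := by
  induction m with
  | zero => exact ha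
  | succ m ih => rw [Function.iterate_succ_apply']; exact hM.bijOn.mapsTo ih

theorem IsBalanced.iterate_neg {M : CayleyData G} (hb : M.IsBalanced) (hM : M.IsCayleyMap)
    (m : ℕ) {a : G} (ha : a ∈ M.Ω) : M.ρ^[m] (-a) = -M.ρ^[m] a := by
  induction m with
  | zero => rfl
  | succ m ih =>
    rw [Function.iterate_succ_apply', Function.iterate_succ_apply', ih,
      hb _ (hM.iterate_mem m ha)]

/-! ### Isomorphisms of Cayley maps are affine -/

namespace Iso

variable {M : CayleyData G} {N : CayleyData H}

theorem iterate_rot (φ : Iso M N) (hM : M.IsCayleyMap) (η : G) (m : ℕ) {a : G} (ha : a ∈ M.Ω) :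
    φ.toEquiv (η + M.ρ^[m] a) - φ.toEquiv η = N.ρ^[m] (φ.toEquiv (η + a) - φ.toEquiv η) := by
  induction m with
  | zero => rfl
  | succ m ih =>
    rw [Function.iterate_succ_apply', Function.iterate_succ_apply', ← ih]
    exact φ.rot η _ (hM.iterate_mem m ha)

/-- If negation is the `n`-th power of the rotation on both sides, the induced function on arcs does
not depend on the starting vertex. -/
theorem sub_eq_of_mem (φ : Iso M N) (hM : M.IsCayleyMap) {n : ℕ}
    (hn : ∀ a ∈ M.Ω, M.ρ^[n] a = -a) (hn' : ∀ b ∈ N.Ω, N.ρ^[n] b = -b) (η : G) {a b : G}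
    (ha : a ∈ M.Ω) (hb : b ∈ M.Ω) :
    φ.toEquiv (η + a + b) - φ.toEquiv (η + a) = φ.toEquiv (η + b) - φ.toEquiv η := by
  -- At the vertex η + a, the arc back to η is the n-th rotate of the arc along a. Since the n-th
  -- rotate is negation on both sides, increments along a at η and at η + a agree.
  have key : φ.toEquiv (η + a + a) - φ.toEquiv (η + a) = φ.toEquiv (η + a) - φ.toEquiv η := by
    have h1 := φ.iterate_rot hM (η + a) n ha
    have h2 : φ.toEquiv (η + a + a) - φ.toEquiv (η + a) ∈ N.Ω := (φ.arc_iff (η + a) a).1 ha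
    rw [hn a ha, hn' _ h2, add_neg_cancel_right] at h1
    rw [← neg_inj, ← h1, neg_sub]
  obtain ⟨m, rfl⟩ := hM.cyclic a ha b hb
  rw [φ.iterate_rot hM _ m ha, φ.iterate_rot hM _ m ha, key]

/-- An isomorphism of Cayley maps whose negations are powers of the rotations is affine. -/
theorem map_add_sub (φ : Iso M N) (hM : M.IsCayleyMap) {n : ℕ}
    (hn : ∀ a ∈ M.Ω, M.ρ^[n] a = -a) (hn' : ∀ b ∈ N.Ω, N.ρ^[n] b = -b) (η g : G) :
    φ.toEquiv (η + g) - φ.toEquiv η = φ.toEquiv g - φ.toEquiv 0 := by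
  -- Two closure inductions: this one varies the base point with the increment in Ω, the next one
  -- varies the increment.
  have h1 : ∀ g : G, ∀ η : G, ∀ b ∈ M.Ω,
      φ.toEquiv (η + g + b) - φ.toEquiv (η + g) = φ.toEquiv (η + b) - φ.toEquiv η := by
    intro g
    have hg : g ∈ AddSubgroup.closure M.Ω := by rw [hM.generates]; trivial
    induction hg using AddSubgroup.closure_induction with
    | mem a ha => intro η b hb; exact φ.sub_eq_of_mem hM hn hn' η ha hb
    | zero => simp
    | add x y _ _ hx hy => intro η b hb; rw [← add_assoc, hy _ b hb, hx η b hb]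
    | neg x _ hx =>
      intro η b hb
      have := hx (η + -x) b hb
      rw [neg_add_cancel_right] at this
      exact this.symm
  have h2 : ∀ g : G, ∀ η : G,
      φ.toEquiv (η + g) - φ.toEquiv η = φ.toEquiv g - φ.toEquiv 0 := by
    intro g
    have hg : g ∈ AddSubgroup.closure M.Ω := by rw [hM.generates]; trivial
    induction hg using AddSubgroup.closure_induction with
    | mem a ha =>
      intro η
      have := h1 η 0 a ha
      rwa [zero_add, zero_add] at this
    | zero => simp
    | add x y _ _ hx hy =>
      intro η
      have e1 := hy (η + x)
      have e2 := hx η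
      have e3 := hy x
      rw [← add_assoc, ← sub_add_sub_cancel _ (φ.toEquiv (η + x)), e1, e2, ← e3]
      abel
    | neg x _ hx =>
      intro η
      have e1 := hx (η + -x)
      have e2 := hx (-x)
      rw [neg_add_cancel_right] at e1
      rw [neg_add_cancel] at e2
      rw [← neg_sub, e1, ← e2, neg_sub]
  exact h2 g η

/-- The group homomorphism underlying an isomorphism of Cayley maps. -/
def toAddMonoidHom (φ : Iso M N) (hM : M.IsCayleyMap) {n : ℕ}
    (hn : ∀ a ∈ M.Ω, M.ρ^[n] a = -a) (hn' : ∀ b ∈ N.Ω, N.ρ^[n] b = -b) : G →+ H where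
  toFun g := φ.toEquiv g - φ.toEquiv 0
  map_zero' := sub_self _
  map_add' a b := by
    have := φ.map_add_sub hM hn hn' a b
    rw [← this]; abel

theorem toAddMonoidHom_injective (φ : Iso M N) (hM : M.IsCayleyMap) {n : ℕ}
    (hn : ∀ a ∈ M.Ω, M.ρ^[n] a = -a) (hn' : ∀ b ∈ N.Ω, N.ρ^[n] b = -b) :
    Function.Injective (φ.toAddMonoidHom hM hn hn') := fun _ _ h =>
  φ.toEquiv.injective (sub_left_injective h)

theorem toAddMonoidHom_mem (φ : Iso M N) (hM : M.IsCayleyMap) {n : ℕ}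
    (hn : ∀ a ∈ M.Ω, M.ρ^[n] a = -a) (hn' : ∀ b ∈ N.Ω, N.ρ^[n] b = -b) {a : G} (ha : a ∈ M.Ω) :
    φ.toAddMonoidHom hM hn hn' a ∈ N.Ω := by
  have := (φ.arc_iff 0 a).1 ha
  rwa [zero_add] at this

theorem toAddMonoidHom_rot (φ : Iso M N) (hM : M.IsCayleyMap) {n : ℕ}
    (hn : ∀ a ∈ M.Ω, M.ρ^[n] a = -a) (hn' : ∀ b ∈ N.Ω, N.ρ^[n] b = -b) {a : G} (ha : a ∈ M.Ω) :
    φ.toAddMonoidHom hM hn hn' (M.ρ a) = N.ρ (φ.toAddMonoidHom hM hn hn' a) := by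
  have := φ.rot 0 a ha
  rwa [zero_add, zero_add] at this

end Iso

/-! ### Type I maps -/

theorem IsTypeIWith.iterate_zero {M : CayleyData G} {n : ℕ} {ω : ℕ → G} (h : M.IsTypeIWith n ω)
    {i : ℕ} (hi : i < n) : M.ρ^[i] (ω 0) = ω i := by
  induction i with
  | zero => rfl
  | succ i ih => rw [Function.iterate_succ_apply', ih (by omega), (h.step i hi).1]

theorem IsTypeIWith.mem {M : CayleyData G} {n : ℕ} {ω : ℕ → G} (h : M.IsTypeIWith n ω)
    {i : ℕ} (hi : i < n) : ω i ∈ M.Ω := by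
  rw [h.set_eq]; exact ⟨i, hi, Or.inl rfl⟩

/-- Going once through the list turns ω 0 into -ω 0; every element of Ω is a rotate of ω 0, and
balancedness lets iterates of ρ commute with negation. -/
theorem IsTypeIWith.iterate_eq_neg {M : CayleyData G} {n : ℕ} {ω : ℕ → G}
    (h : M.IsTypeIWith n ω) (hn : 0 < n) (hM : M.IsCayleyMap) (hb : M.IsBalanced) {a : G}
    (ha : a ∈ M.Ω) : M.ρ^[n] a = -a := by
  have h0 : M.ρ^[n] (ω 0) = -ω 0 := by
    obtain ⟨m, rfl⟩ : ∃ m, n = m + 1 := ⟨n - 1, by omega⟩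
    rw [Function.iterate_succ_apply', h.iterate_zero (Nat.lt_succ_self m)]
    exact h.last.1
  obtain ⟨m, rfl⟩ := hM.cyclic _ (h.mem hn) a ha
  rw [← Function.iterate_add_apply, add_comm, Function.iterate_add_apply, h0,
    hb.iterate_neg hM m (h.mem hn)]

/-- The rotation of a regular balanced Cayley map of type I extends to a group endomorphism. -/
theorem IsTypeIRBCM.exists_addMonoidHom {M : CayleyData G} {n : ℕ} (hM : M.IsTypeIRBCM n)
    (hn : 0 < n) : ∃ α : G →+ G, ∀ a ∈ M.Ω, α a = M.ρ a := by
  obtain ⟨ω, hω⟩ := hM.typeI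
  have hC := hM.isCayleyMap
  have hneg : ∀ a ∈ M.Ω, M.ρ^[n] a = -a := fun a ha => hω.iterate_eq_neg hn hC hM.balanced ha
  have h0 := hω.mem hn
  -- This automorphism fixes 0 and rotates one arc at 0 by one step, hence rotates all arcs at 0 by
  -- one step.
  obtain ⟨φ, hφ0, hφ1⟩ := hM.regular 0 0 (ω 0) h0 (M.ρ (ω 0)) (hC.bijOn.mapsTo h0)
  rw [zero_add, zero_add] at hφ1
  refine ⟨φ.toAddMonoidHom hC hneg hneg, fun a ha => ?_⟩
  obtain ⟨m, rfl⟩ := hC.cyclic _ h0 a ha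
  have := φ.iterate_rot hC 0 m h0
  rw [zero_add, zero_add, hφ0, hφ1, sub_zero, sub_zero, ← Function.iterate_succ_apply,
    Function.iterate_succ_apply'] at this
  change φ.toEquiv _ - φ.toEquiv 0 = _
  rw [hφ0, this, sub_zero]

/-! ### Transport along a group isomorphism -/

section Transport

variable {M : CayleyData G} {N : CayleyData H} (θ : G ≃+ H) (hΩ : N.Ω = θ '' M.Ω)
  (hρ : ∀ a ∈ M.Ω, N.ρ (θ a) = θ (M.ρ a))

include hΩ hρ

theorem IsCayleyMap.transport (hM : M.IsCayleyMap) : N.IsCayleyMap where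
  finite := by
    have := hM.finite
    exact Finite.of_equiv G θ.toEquiv
  zero_notMem := by
    rw [hΩ]
    rintro ⟨a, ha, h⟩
    rw [EmbeddingLike.map_eq_zero_iff] at h
    exact hM.zero_notMem (h ▸ ha)
  neg_mem := by
    rw [hΩ]
    rintro _ ⟨a, ha, rfl⟩
    exact ⟨-a, hM.neg_mem a ha, map_neg θ a⟩
  generates := by
    have := AddMonoidHom.map_closure θ.toAddMonoidHom M.Ω
    rw [hM.generates] at this
    rw [hΩ]
    refine this.symm.trans ?_
    rw [← AddMonoidHom.range_eq_map]
    exact AddMonoidHom.range_eq_top.2 θ.surjective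
  bijOn := by
    rw [hΩ]
    refine ⟨?_, ?_, ?_⟩
    · rintro _ ⟨a, ha, rfl⟩
      exact ⟨M.ρ a, hM.bijOn.mapsTo ha, (hρ a ha).symm⟩
    · rintro _ ⟨a, ha, rfl⟩ _ ⟨b, hb, rfl⟩ h
      rw [hρ a ha, hρ b hb] at h
      rw [hM.bijOn.injOn ha hb (θ.injective h)]
    · rintro _ ⟨a, ha, rfl⟩
      obtain ⟨b, hb, rfl⟩ := hM.bijOn.surjOn ha
      exact ⟨θ b, ⟨b, hb, rfl⟩, hρ b hb⟩
  cyclic := by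
    rw [hΩ]
    rintro _ ⟨a, ha, rfl⟩ _ ⟨b, hb, rfl⟩
    obtain ⟨m, rfl⟩ := hM.cyclic a ha b hb
    refine ⟨m, ?_⟩
    clear hb
    induction m with
    | zero => rfl
    | succ m ih =>
      rw [Function.iterate_succ_apply', Function.iterate_succ_apply', ih,
        hρ _ (hM.iterate_mem m ha)]

/-- A group isomorphism compatible with the connection sets and the rotations is an isomorphism of
Cayley maps. -/
def isoOfAddEquiv : Iso M N where
  toEquiv := θ.toEquiv
  arc_iff η ω := by
    change _ ↔ θ (η + ω) - θ η ∈ _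
    rw [map_add, add_sub_cancel_left, hΩ]
    exact (θ.injective.mem_set_image).symm
  rot η ω hω := by
    change θ (η + _) - θ η = N.ρ (θ (η + ω) - θ η)
    rw [map_add, map_add, add_sub_cancel_left, add_sub_cancel_left, hρ ω hω]

theorem IsTypeIWith.transport {n : ℕ} (hn : 0 < n) {ω : ℕ → G} {ω' : ℕ → H}
    (hM : M.IsCayleyMap) (h : M.IsTypeIWith n ω) (hω : ∀ i < n, ω' i = θ (ω i)) :
    N.IsTypeIWith n ω' where
  valency := by
    rw [hΩ, Set.ncard_image_of_injective _ θ.injective, h.valency]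
  set_eq := by
    rw [hΩ, h.set_eq]
    ext y
    constructor
    · rintro ⟨_, ⟨i, hi, rfl | rfl⟩, rfl⟩
      · exact ⟨i, hi, Or.inl (hω i hi).symm⟩
      · exact ⟨i, hi, Or.inr (by rw [map_neg, hω i hi])⟩
    · rintro ⟨i, hi, rfl | rfl⟩
      · exact ⟨_, ⟨i, hi, Or.inl rfl⟩, (hω i hi).symm⟩
      · exact ⟨_, ⟨i, hi, Or.inr rfl⟩, by rw [map_neg, hω i hi]⟩
  step i hi := by
    have h1 := h.mem (show i < n by omega)
    rw [hω i (by omega), hω (i + 1) hi, ← map_neg, ← map_neg, hρ _ h1, hρ _ (hM.neg_mem _ h1),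
      (h.step i hi).1, (h.step i hi).2]
    exact ⟨rfl, rfl⟩
  last := by
    have h1 := h.mem (show n - 1 < n by omega)
    rw [hω (n - 1) (by omega), hω 0 hn, ← map_neg, ← map_neg, hρ _ h1, hρ _ (hM.neg_mem _ h1),
      h.last.1, h.last.2]
    exact ⟨rfl, rfl⟩

end Transport

end CayleyData

/-! ### Hensel lifting of factorizations modulo powers of two -/

/-- Hensel's step: if F - gh = 2^(k+1) e, then g is corrected by 2^(k+1) b e, but only its remainder
u modulo g is used, so that g stays monic; the quotient s goes into the cofactor. -/
theorem exists_monic_mul_sub_dvd {F g₀ h₀ a b : ℤ[X]} (hg : g₀.Monic) (hF : 2 ∣ F - g₀ * h₀)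
    (hab : 2 ∣ 1 - (a * g₀ + b * h₀)) (k : ℕ) :
    ∃ g h : ℤ[X], g.Monic ∧ 2 ∣ g - g₀ ∧ 2 ∣ h - h₀ ∧ 2 ^ (k + 1) ∣ F - g * h := by
  induction k with
  | zero => exact ⟨g₀, h₀, hg, by simp, by simp, by simpa using hF⟩
  | succ k ih =>
    obtain ⟨g, h, hgm, ⟨g', hg'⟩, ⟨h', hh'⟩, ⟨e, he⟩⟩ := ih
    obtain ⟨c, hc⟩ := hab
    have hdiv := modByMonic_add_div (b * e) g
    set u := (b * e) %ₘ g
    set s := (b * e) /ₘ g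
    have hu : u.degree < g.degree := degree_modByMonic_lt _ hgm
    refine ⟨g + 2 ^ (k + 1) * u, h + 2 ^ (k + 1) * (a * e + s * h), ?_, ?_, ?_, ?_⟩
    · refine hgm.add_of_left (lt_of_le_of_lt ?_ hu)
      have : (2 : ℤ[X]) ^ (k + 1) = C (2 ^ (k + 1)) := by simp
      rw [this, C_mul']
      exact degree_smul_le _ _
    · exact ⟨g' + 2 ^ k * u, by linear_combination hg'⟩
    · exact ⟨h' + 2 ^ k * (a * e + s * h), by linear_combination hh'⟩
    · refine ⟨e * (c - a * g' - b * h') - 2 ^ k * u * (a * e + s * h), ?_⟩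
      linear_combination he - 2 ^ (k + 1) * h * hdiv + 2 ^ (k + 1) * e * (hc - a * hg' - b * hh')

theorem two_dvd_iff_map_eq_zero (p : ℤ[X]) :
    2 ∣ p ↔ p.map (Int.castRingHom (ZMod 2)) = 0 := by
  rw [← C_ofNat, C_dvd_iff_dvd_coeff, Polynomial.ext_iff]
  refine forall_congr' fun i => ?_
  rw [coeff_map, coeff_zero, eq_intCast, ZMod.intCast_zmod_eq_zero_iff_dvd]
  rfl

theorem two_pow_eq_zero (k : ℕ) : (2 : (ZMod (2 ^ k))[X]) ^ k = 0 := by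
  have : ((2 ^ k : ℕ) : (ZMod (2 ^ k))[X]) = C ((2 ^ k : ℕ) : ZMod (2 ^ k)) := by simp
  rw [ZMod.natCast_self, C_0] at this
  exact_mod_cast this

theorem isUnit_of_two_dvd_sub_one (k : ℕ) {p : (ZMod (2 ^ k))[X]} (hp : 2 ∣ p - 1) : IsUnit p := by
  obtain ⟨c, hc⟩ := hp
  have : IsNilpotent (p - 1) := ⟨k, by rw [hc, mul_pow, two_pow_eq_zero, zero_mul]⟩
  simpa using this.isUnit_add_one

section ModTwo

variable (k : ℕ) [NeZero k]

/-- Reduction modulo `2`. -/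
abbrev modTwo : ZMod (2 ^ k) →+* ZMod 2 :=
  ZMod.castHom (dvd_pow_self 2 (NeZero.ne k)) (ZMod 2)

theorem modTwo_comp_intCast :
    (modTwo k).comp (Int.castRingHom (ZMod (2 ^ k))) = Int.castRingHom (ZMod 2) :=
  RingHom.ext_int _ _

theorem two_dvd_of_map_eq_zero {p : (ZMod (2 ^ k))[X]} (hp : p.map (modTwo k) = 0) : 2 ∣ p := by
  obtain ⟨P, rfl⟩ := map_surjective _ (ZMod.ringHom_surjective (Int.castRingHom (ZMod (2 ^ k)))) p
  rw [map_map, modTwo_comp_intCast, ← two_dvd_iff_map_eq_zero] at hp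
  obtain ⟨Q, rfl⟩ := hp
  exact ⟨Q.map (Int.castRingHom _), by simp⟩

theorem modTwo_map_surjective : Function.Surjective (Polynomial.map (modTwo k)) :=
  map_surjective _ (ZMod.ringHom_surjective _)

/-- Coprimality can be tested modulo `2`. -/
theorem isCoprime_of_map_modTwo {p q : (ZMod (2 ^ k))[X]}
    (h : IsCoprime (p.map (modTwo k)) (q.map (modTwo k))) : IsCoprime p q := by
  obtain ⟨a', b', hab⟩ := h
  obtain ⟨a, rfl⟩ := modTwo_map_surjective k a'
  obtain ⟨b, rfl⟩ := modTwo_map_surjective k b'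
  have hu : IsUnit (a * p + b * q) := isUnit_of_two_dvd_sub_one k
    (two_dvd_of_map_eq_zero k (by simp [hab]))
  obtain ⟨v, hv⟩ := hu.exists_left_inv
  exact ⟨v * a, v * b, by linear_combination hv⟩

theorem exists_monic_dvd_of_map_eq_mul {F : (ZMod (2 ^ k))[X]} {q c : (ZMod 2)[X]}
    (hq : q.Monic) (hqc : IsCoprime q c) (hF : F.map (modTwo k) = q * c) :
    ∃ f : (ZMod (2 ^ k))[X], f.Monic ∧ f ∣ F ∧ f.map (modTwo k) = q := by
  have hs : Function.Surjective (Polynomial.map (Int.castRingHom (ZMod 2))) :=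
    map_surjective _ (ZMod.ringHom_surjective _)
  obtain ⟨F, rfl⟩ := map_surjective _ (ZMod.ringHom_surjective (Int.castRingHom (ZMod (2 ^ k)))) F
  rw [map_map, modTwo_comp_intCast] at hF
  obtain ⟨g₀, hg₀, -, hgm⟩ := lifts_and_natDegree_eq_and_monic
    ((mem_lifts (f := Int.castRingHom (ZMod 2)) q).2 (hs q)) hq
  obtain ⟨h₀, rfl⟩ := hs c
  obtain ⟨a', b', hab⟩ := hqc
  obtain ⟨a, rfl⟩ := hs a'
  obtain ⟨b, rfl⟩ := hs b'
  subst hg₀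
  obtain ⟨g, h, hg, hgg, -, d, hd⟩ := exists_monic_mul_sub_dvd (a := a) (b := b) (h₀ := h₀) (F := F)
    hgm ((two_dvd_iff_map_eq_zero _).2 (by simp [hF]))
    ((two_dvd_iff_map_eq_zero _).2 (by simp [hab])) k
  refine ⟨g.map (Int.castRingHom _), hg.map _, ⟨h.map (Int.castRingHom _), ?_⟩, ?_⟩
  · have := congrArg (Polynomial.map (Int.castRingHom (ZMod (2 ^ k)))) hd
    rw [Polynomial.map_mul, Polynomial.map_pow, Polynomial.map_ofNat, pow_succ, two_pow_eq_zero,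
      zero_mul, zero_mul, Polynomial.map_sub, Polynomial.map_mul, sub_eq_zero] at this
    exact this
  · rw [map_map, modTwo_comp_intCast, ← sub_eq_zero, ← Polynomial.map_sub]
    exact (two_dvd_iff_map_eq_zero _).1 hgg

end ModTwo

/-! ### The irreducible factors of `x ^ n' - 1` modulo two -/

instance Lam.finite (n' : ℕ) : Finite (Lam n') := by
  have (d : {d : ℕ // d ∈ n'.divisors}) : NeZero (d : ℕ) :=
    ⟨(Nat.pos_of_mem_divisors d.2).ne'⟩
  unfold Lam
  infer_instance

section Factors

variable (η : ℕ → F2bar) {n' : ℕ}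

/-- The root `η_d ^ ℓ` of `q_{d,ℓ}`. -/
noncomputable def Lam.root (l : Lam n') : F2bar :=
  η l.1 ^ ((Quotient.out l.2 : (ZMod (l.1 : ℕ))ˣ) : ZMod (l.1 : ℕ)).val

/-- The polynomial `q_λ` over the field with two elements. -/
noncomputable def qBase (l : Lam n') : (ZMod 2)[X] := minpoly (ZMod 2) (l.root η)

theorem Lam.dvd (l : Lam n') : (l.1 : ℕ) ∣ n' := Nat.dvd_of_mem_divisors l.1.2

theorem Lam.ne_zero (l : Lam n') : (l.1 : ℕ) ≠ 0 := (Nat.pos_of_mem_divisors l.1.2).ne'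

theorem Lam.coprime (hn' : ¬ 2 ∣ n') (l : Lam n') : Nat.Coprime 2 l.1 :=
  (Nat.Prime.coprime_iff_not_dvd Nat.prime_two).2 fun h => hn' (h.trans l.dvd)

theorem qBase_monic (l : Lam n') : (qBase η l).Monic :=
  minpoly.monic (Algebra.IsIntegral.isIntegral _)

theorem qBase_irreducible (l : Lam n') : Irreducible (qBase η l) :=
  minpoly.irreducible (Algebra.IsIntegral.isIntegral _)

/-- Frobenius: q(x^2) = q(x)^2 over the field with two elements. -/
theorem aeval_root_pow_two_pow (l : Lam n') (j : ℕ) :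
    aeval (l.root η ^ 2 ^ j) (qBase η l) = 0 := by
  induction j with
  | zero => rw [pow_zero, pow_one]; exact minpoly.aeval _ _
  | succ j ih =>
    rw [pow_succ, pow_mul, ← expand_aeval, ZMod.expand_card, map_pow, ih, zero_pow two_ne_zero]

variable (hη : ∀ d, d ∣ n' → IsPrimitiveRoot (η d) d)

include hη

theorem Lam.root_isPrimitiveRoot (l : Lam n') : IsPrimitiveRoot (l.root η) l.1 :=
  (hη _ l.dvd).pow_of_coprime _ (ZMod.val_coe_unit_coprime _)

theorem Lam.root_pow_two_pow_eq_iff (l : Lam n') (i j : ℕ) :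
    l.root η ^ 2 ^ i = l.root η ^ 2 ^ j ↔ (2 : ZMod l.1) ^ i = 2 ^ j := by
  have h := l.root_isPrimitiveRoot η hη
  have hf : IsOfFinOrder (l.root η) := by
    rw [← orderOf_pos_iff, ← h.eq_orderOf]
    exact Nat.pos_of_ne_zero l.ne_zero
  rw [hf.pow_eq_pow_iff_modEq, ← h.eq_orderOf, ← ZMod.natCast_eq_natCast_iff]
  push_cast
  rfl

variable (hn' : ¬ 2 ∣ n')

include hn'

/-- `qBase` divides the d-th cyclotomic polynomial, all of whose irreducible factors over 𝔽₂ have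
degree o(2,d). -/
theorem natDegree_qBase (l : Lam n') : (qBase η l).natDegree = orderOf (2 : ZMod l.1) := by
  have h := l.root_isPrimitiveRoot η hη
  have hd : qBase η l ∣ cyclotomic l.1 (ZMod 2) := by
    apply minpoly.dvd
    rw [aeval_def, ← eval_map, map_cyclotomic]
    exact h.isRoot_cyclotomic (Nat.pos_of_ne_zero l.ne_zero)
  rw [natDegree_of_dvd_cyclotomic_of_irreducible (K := ZMod 2) (p := 2) (f := 1) (by simp)
    (Lam.coprime hn' l) hd (qBase_irreducible η l), ← orderOf_units]
  simp

/-- The o(2,d) Frobenius conjugates of the root are distinct and exhaust the degree of its minimal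
polynomial. Thus `qRed` descends to 𝔽₂ and is irreducible there. -/
theorem map_qBase (l : Lam n') : (qBase η l).map (algebraMap (ZMod 2) F2bar) = qRed η l := by
  have h2 : qRed η l = ∏ j ∈ Finset.range (orderOf (2 : ZMod (l.1 : ℕ))),
      (X - C (l.root η ^ 2 ^ j)) := by
    refine Finset.prod_congr rfl fun j _ => ?_
    rw [Lam.root, pow_mul]
  rw [h2]
  refine eq_of_monic_of_dvd_of_natDegree_le
    (monic_prod_of_monic _ (fun j => X - C (l.root η ^ 2 ^ j)) fun j _ => monic_X_sub_C _)
    ((qBase_monic η l).map _) ?_ ?_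
  · refine Finset.prod_dvd_of_coprime (fun i hi j hj hij => ?_) fun j _ => ?_
    · refine isCoprime_X_sub_C_of_isUnit_sub (sub_ne_zero.2 fun h => hij ?_).isUnit
      rw [l.root_pow_two_pow_eq_iff η hη] at h
      exact pow_injOn_Iio_orderOf (Finset.mem_range.1 hi) (Finset.mem_range.1 hj) h
    · rw [dvd_iff_isRoot, IsRoot.def, eval_map_algebraMap]
      exact aeval_root_pow_two_pow η l j
  · rw [natDegree_map, natDegree_qBase η hη hn', natDegree_prod_of_monic _
      (fun j => X - C (l.root η ^ 2 ^ j)) fun j _ => monic_X_sub_C (l.root η ^ 2 ^ j)]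
    simp only [natDegree_X_sub_C, Finset.sum_const, Finset.card_range, smul_eq_mul, mul_one,
      le_refl]

theorem aeval_qBase_eq_zero_iff (l : Lam n') (z : F2bar) :
    aeval z (qBase η l) = 0 ↔ ∃ j, z = l.root η ^ 2 ^ j := by
  refine ⟨fun h => ?_, ?_⟩
  · rw [← eval_map_algebraMap, map_qBase η hη hn', qRed, eval_prod, Finset.prod_eq_zero_iff] at h
    obtain ⟨j, -, hj⟩ := h
    refine ⟨j, ?_⟩
    rw [Lam.root, ← pow_mul]
    simpa [sub_eq_zero] using hj
  · rintro ⟨j, rfl⟩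
    exact aeval_root_pow_two_pow η l j

/-- A common root has a single order, so d agrees; the two exponents then differ by a power of 2, so
the cosets agree. -/
theorem qBase_isCoprime {l m : Lam n'} (hlm : l ≠ m) : IsCoprime (qBase η l) (qBase η m) := by
  refine (dvd_or_isCoprime _ _ (qBase_irreducible η l)).resolve_left fun hdvd => hlm ?_
  have h0 : aeval (l.root η) (qBase η m) = 0 := by
    obtain ⟨c, hc⟩ := hdvd
    rw [hc, map_mul]
    have : aeval (l.root η) (qBase η l) = 0 := minpoly.aeval _ _
    rw [this, zero_mul]
  obtain ⟨j, hj⟩ := (aeval_qBase_eq_zero_iff η hη hn' m _).1 h0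
  have hl := l.root_isPrimitiveRoot η hη
  have hm := (m.root_isPrimitiveRoot η hη).pow_of_coprime _ ((Lam.coprime hn' m).pow_left j)
  rw [← hj] at hm
  have hd := hl.unique hm
  have hc := Lam.coprime hn' l
  have hp := hη _ l.dvd
  obtain ⟨⟨d, hd1⟩, x⟩ := l
  obtain ⟨⟨d', hd2⟩, y⟩ := m
  obtain rfl : d = d' := hd
  have : NeZero d := ⟨(Nat.pos_of_mem_divisors hd1).ne'⟩
  suffices x = y by rw [this]
  have hp : IsPrimitiveRoot (η d) d := hp
  have hf : IsOfFinOrder (η d) := by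
    rw [← orderOf_pos_iff, ← hp.eq_orderOf]
    exact Nat.pos_of_ne_zero (NeZero.ne d)
  simp only [Lam.root] at hj
  rw [← pow_mul, hf.pow_eq_pow_iff_modEq, ← hp.eq_orderOf, ← ZMod.natCast_eq_natCast_iff] at hj
  push_cast at hj
  rw [ZMod.natCast_zmod_val, ZMod.natCast_zmod_val] at hj
  rw [← Quotient.out_eq x, ← Quotient.out_eq y]
  refine (QuotientGroup.eq.2 ?_).symm
  have hmem : (ZMod.unitOfCoprime 2 hc) ^ j ∈ twoPowers d :=
    Subgroup.pow_mem _ (Subgroup.subset_closure (by simp)) _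
  convert hmem using 1
  rw [inv_mul_eq_iff_eq_mul]
  ext
  simpa using hj

/-- If z has order d, then z = η_d^i with i prime to d. The chosen representative of the coset of i
differs from i by a power of 2, so its root is conjugate to z. -/
theorem exists_aeval_qBase_eq_zero {z : F2bar} (hz : z ^ n' = 1) :
    ∃ l : Lam n', aeval z (qBase η l) = 0 := by
  have hn0 : n' ≠ 0 := fun h => hn' (h ▸ dvd_zero 2)
  have hd : orderOf z ∈ n'.divisors := Nat.mem_divisors.2 ⟨orderOf_dvd_of_pow_eq_one hz, hn0⟩
  have hp := hη _ (orderOf_dvd_of_pow_eq_one hz)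
  have : NeZero (orderOf z) := ⟨(Nat.pos_of_mem_divisors hd).ne'⟩
  obtain ⟨i, -, hi, hzi⟩ := hp.isPrimitiveRoot_iff.1 (IsPrimitiveRoot.orderOf z)
  let u : (ZMod (orderOf z))ˣ := ZMod.unitOfCoprime i hi
  let l : Lam n' := ⟨⟨orderOf z, hd⟩, (u : _ ⧸ twoPowers (orderOf z))⟩
  refine ⟨l, (aeval_qBase_eq_zero_iff η hη hn' l z).2 ?_⟩
  have hu : (Quotient.out l.2 : (ZMod (orderOf z))ˣ)⁻¹ * u ∈ twoPowers (orderOf z) :=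
    QuotientGroup.eq.1 (Quotient.out_eq _)
  have hset : {v : (ZMod (orderOf z))ˣ | (v : ZMod (orderOf z)) = 2} =
      {ZMod.unitOfCoprime 2 (Lam.coprime hn' l)} := by
    ext v
    simp [Units.ext_iff]
  change _ ∈ Subgroup.closure _ at hu
  rw [hset, ← Subgroup.zpowers_eq_closure, ← mem_powers_iff_mem_zpowers] at hu
  obtain ⟨j, hj⟩ := hu
  refine ⟨j, ?_⟩
  have hf : IsOfFinOrder (η (orderOf z)) := by
    rw [← orderOf_pos_iff, ← hp.eq_orderOf]
    exact Nat.pos_of_ne_zero (NeZero.ne _)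
  have hu : (u : ZMod (orderOf z)) = (Quotient.out l.2 : (ZMod (orderOf z))ˣ) * 2 ^ j := by
    have := (eq_inv_mul_iff_mul_eq.1 hj).symm
    rw [Units.ext_iff] at this
    simpa using this
  refine hzi.symm.trans ?_
  change _ = (η (orderOf z) ^ _) ^ _
  rw [← pow_mul, hf.pow_eq_pow_iff_modEq, ← hp.eq_orderOf, ← ZMod.natCast_eq_natCast_iff]
  push_cast
  rw [ZMod.natCast_zmod_val]
  exact hu

/-- The product divides by coprimality. Conversely each n'-th root of unity is a root of some
factor, which bounds the degree of x^n' - 1. -/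
theorem prod_qBase [Fintype (Lam n')] : ∏ l : Lam n', qBase η l = X ^ n' - 1 := by
  have hn0 : n' ≠ 0 := fun h => hn' (h ▸ dvd_zero 2)
  refine Eq.symm <| eq_of_monic_of_dvd_of_natDegree_le
    (monic_prod_of_monic _ _ fun l _ => qBase_monic η l)
    (by simpa using monic_X_pow_sub_C (1 : ZMod 2) hn0) ?_ (natDegree_le_of_dvd ?_ ?_)
  · refine Finset.prod_dvd_of_coprime (fun l _ m _ h => qBase_isCoprime η hη hn' h) fun l _ => ?_
    apply minpoly.dvd
    have := (l.root_isPrimitiveRoot η hη).pow_eq_one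
    obtain ⟨c, hc⟩ := l.dvd
    simp [hc, pow_mul, this]
  · rw [← map_dvd_map' (algebraMap (ZMod 2) F2bar)]
    have h1 := X_pow_sub_one_eq_prod (Nat.pos_of_ne_zero hn0) (hη n' dvd_rfl)
    simp only [Polynomial.map_sub, Polynomial.map_pow, map_X, Polynomial.map_one]
    rw [h1]
    refine Finset.prod_dvd_of_coprime (fun i hi j hj hij => ?_) fun z hz => ?_
    · exact isCoprime_X_sub_C_of_isUnit_sub (sub_ne_zero.2 hij).isUnit
    · rw [mem_nthRootsFinset (Nat.pos_of_ne_zero hn0)] at hz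
      obtain ⟨l, hl⟩ := exists_aeval_qBase_eq_zero η hη hn' hz
      refine Dvd.dvd.trans ?_ (Polynomial.map_dvd _ (Finset.dvd_prod_of_mem _ (Finset.mem_univ l)))
      rwa [dvd_iff_isRoot, IsRoot.def, eval_map_algebraMap]
  · exact (monic_prod_of_monic _ _ fun l _ => qBase_monic η l).ne_zero

end Factors

/-! ### Rings whose non-units are the multiples of a nilpotent element -/

section Chain

variable {B : Type*} [CommRing B] {π : B} {N : ℕ}

/-- If π^(e+1) is the first power whose ideal does not contain I, some π^e a ∈ I has a not divisible
by π, hence a unit. -/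
theorem exists_eq_span_pow (hπ : ∀ a, π ∣ a ∨ IsUnit a) (hN : π ^ N = 0) (I : Ideal B) :
    ∃ e ≤ N, I = Ideal.span {π ^ e} := by
  classical
  by_cases hI : I ≤ Ideal.span {π ^ N}
  · refine ⟨N, le_rfl, ?_⟩
    rw [hN, Ideal.span_singleton_eq_bot.2 rfl] at hI ⊢
    exact le_bot_iff.1 hI
  · have hex : ∃ e, ¬ I ≤ Ideal.span {π ^ e} := ⟨N, hI⟩
    have h1 := Nat.find_spec hex
    have h2 : Nat.find hex ≤ N := Nat.find_min' hex hI
    obtain ⟨e, he⟩ : ∃ e, Nat.find hex = e + 1 := by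
      refine Nat.exists_eq_succ_of_ne_zero fun h => ?_
      rw [h] at h1
      simp at h1
    rw [he] at h1 h2
    have h3 : I ≤ Ideal.span {π ^ e} := by
      by_contra h
      have := Nat.find_min' hex h
      omega
    refine ⟨e, by omega, le_antisymm h3 ?_⟩
    obtain ⟨x, hx, hx'⟩ := SetLike.not_le_iff_exists.1 h1
    obtain ⟨a, rfl⟩ := Ideal.mem_span_singleton.1 (h3 hx)
    rcases hπ a with ⟨b, rfl⟩ | ha
    · exact absurd (Ideal.mem_span_singleton.2 ⟨b, by ring⟩) hx'
    · rw [Ideal.span_singleton_le_iff_mem]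
      obtain ⟨v, hv⟩ := ha.exists_right_inv
      have := I.mul_mem_right v hx
      rwa [mul_assoc, hv, mul_one] at this

/-- From π^d = π^e c one gets π^d (1 - π^(e-d) c) = 0, and the second factor is a unit because π is
nilpotent. -/
theorem pow_eq_zero_of_dvd_pow_of_lt (hN : π ^ N = 0) {d e : ℕ} (hde : d < e)
    (h : π ^ e ∣ π ^ d) : π ^ d = 0 := by
  obtain ⟨c, hc⟩ := h
  obtain ⟨m, rfl⟩ : ∃ m, e = d + m + 1 := ⟨e - d - 1, by omega⟩
  have hu : IsUnit (1 - π ^ (m + 1) * c) := by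
    refine IsNilpotent.isUnit_one_sub ⟨N, ?_⟩
    rw [mul_pow, ← pow_mul, pow_eq_zero_of_le (Nat.le_mul_of_pos_left N m.succ_pos) hN, zero_mul]
  refine (hu.mul_left_eq_zero).1 ?_
  linear_combination hc

theorem span_pow_injective (hN : π ^ N = 0) (hN' : ∀ e < N, π ^ e ≠ 0) {d e : ℕ} (hd : d ≤ N)
    (he : e ≤ N) (h : Ideal.span {π ^ d} = Ideal.span {π ^ e}) : d = e := by
  have h1 : π ^ e ∣ π ^ d := Ideal.span_singleton_le_span_singleton.1 h.le
  have h2 : π ^ d ∣ π ^ e := Ideal.span_singleton_le_span_singleton.1 h.ge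
  rcases lt_trichotomy d e with hlt | rfl | hlt
  · exact absurd (pow_eq_zero_of_dvd_pow_of_lt hN hlt h1) (hN' d (by omega))
  · rfl
  · exact absurd (pow_eq_zero_of_dvd_pow_of_lt hN hlt h2) (hN' e (by omega))

end Chain

/-! ### Ideals containing a product of pairwise coprime elements -/

section Coprime

variable {A ι : Type*} [CommRing A] [Fintype ι] {T : ι → A}

theorem exists_idempotents_of_coprime (hT : Pairwise fun i j => IsCoprime (T i) (T j)) (i : ι) :
    ∃ e : A, T i ∣ 1 - e ∧ ∀ j, j ≠ i → T j ∣ e := by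
  classical
  have : IsCoprime (T i) (∏ j ∈ Finset.univ.erase i, T j) :=
    IsCoprime.prod_right fun j hj => hT (Finset.ne_of_mem_erase hj).symm
  obtain ⟨a, b, hab⟩ := this
  refine ⟨b * ∏ j ∈ Finset.univ.erase i, T j, ⟨a, by linear_combination -hab⟩, fun j hj => ?_⟩
  exact (Finset.dvd_prod_of_mem T (Finset.mem_erase.2 ⟨hj, Finset.mem_univ j⟩)).mul_left _

/-- Chinese remaindering: I is the intersection of its localized versions I + (T i). The coprime
moduli are merged one at a time until their product lies in I. -/
theorem mem_of_forall_mem_sup_span (hT : Pairwise fun i j => IsCoprime (T i) (T j)) {I : Ideal A}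
    (hI : ∏ i, T i ∈ I) {f : A} (hf : ∀ i, f ∈ I ⊔ Ideal.span {T i}) : f ∈ I := by
  classical
  have key : ∀ s : Finset ι, f ∈ I ⊔ Ideal.span {∏ i ∈ s, T i} := by
    intro s
    induction s using Finset.induction_on with
    | empty => simp
    | insert i s hi ih =>
      have hc : IsCoprime (T i) (∏ j ∈ s, T j) :=
        IsCoprime.prod_right fun j hj => hT fun h => hi (h ▸ hj)
      obtain ⟨a, b, hab⟩ := hc
      obtain ⟨x, hx, y, hy, hxy⟩ := Submodule.mem_sup.1 (hf i)
      obtain ⟨x', hx', y', hy', hxy'⟩ := Submodule.mem_sup.1 ih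
      obtain ⟨c, rfl⟩ := Ideal.mem_span_singleton.1 hy
      obtain ⟨c', rfl⟩ := Ideal.mem_span_singleton.1 hy'
      rw [Finset.prod_insert hi]
      refine Submodule.mem_sup.2 ⟨b * (∏ j ∈ s, T j) * x + a * T i * x',
        I.add_mem (I.mul_mem_left _ hx) (I.mul_mem_left _ hx'), T i * (∏ j ∈ s, T j) * (b * c + a * c'),
        Ideal.mem_span_singleton.2 ⟨_, rfl⟩, ?_⟩
      linear_combination f * hab + b * (∏ j ∈ s, T j) * hxy + a * T i * hxy'
  have := key Finset.univ
  rwa [sup_eq_left.2 ((Ideal.span_singleton_le_iff_mem I).2 hI)] at this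

/-- Uniqueness half of the same decomposition: an element ≡ 1 mod T i and ≡ 0 mod the other T j
moves I i into the intersection. -/
theorem iInf_sup_span_eq (hT : Pairwise fun i j => IsCoprime (T i) (T j)) {I : ι → Ideal A}
    (hI : ∀ i, T i ∈ I i) (i : ι) : (⨅ j, I j) ⊔ Ideal.span {T i} = I i := by
  refine le_antisymm (sup_le (iInf_le _ _) ((Ideal.span_singleton_le_iff_mem _).2 (hI i))) ?_
  intro f hf
  obtain ⟨e, ⟨c, hc⟩, he⟩ := exists_idempotents_of_coprime hT i
  refine Submodule.mem_sup.2 ⟨f * e, ?_, T i * (f * c), Ideal.mem_span_singleton.2 ⟨_, rfl⟩, ?_⟩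
  · refine Ideal.mem_iInf.2 fun j => ?_
    by_cases hj : j = i
    · subst hj
      exact Ideal.mul_mem_right _ _ hf
    · exact Ideal.mul_mem_left _ _ (Ideal.mem_of_dvd _ (he j hj) (hI j))
  · linear_combination -f * hc

theorem pi_mk_surjective (hT : Pairwise fun i j => IsCoprime (T i) (T j)) {I : ι → Ideal A}
    (hI : ∀ i, T i ∈ I i) :
    Function.Surjective fun (p : A) (i : ι) => Ideal.Quotient.mk (I i) p := by
  intro y
  choose p hp using fun i => Ideal.Quotient.mk_surjective (y i)
  choose e he he' using exists_idempotents_of_coprime hT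
  refine ⟨∑ j, p j * e j, ?_⟩
  funext i
  rw [← hp i, Ideal.Quotient.mk_eq_mk_iff_sub_mem]
  classical
  rw [← Finset.add_sum_erase _ _ (Finset.mem_univ i), add_sub_right_comm]
  refine (I i).add_mem ?_ (Ideal.sum_mem _ fun j hj => ?_)
  · obtain ⟨c, hc⟩ := he i
    have : p i * e i - p i = T i * (-c * p i) := by linear_combination -p i * hc
    rw [this]
    exact Ideal.mul_mem_right _ _ (hI i)
  · exact Ideal.mul_mem_left _ _
      (Ideal.mem_of_dvd _ (he' j i (Finset.ne_of_mem_erase hj).symm) (hI i))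

end Coprime

/-! ### Auxiliary identities: powers of y - 1 and digits of exponents -/

theorem exists_sub_one_pow_two_pow_eq {R : Type*} [CommRing R] (y : R) (r : ℕ) :
    ∃ h : R, (y - 1) ^ 2 ^ r = y ^ 2 ^ r + 1 + 2 * ((y - 1) * h - 1) := by
  induction r with
  | zero => exact ⟨0, by ring⟩
  | succ r ih =>
    obtain ⟨h, hh⟩ := ih
    obtain ⟨g, hg⟩ : y - 1 ∣ y ^ 2 ^ r - 1 := by simpa using sub_dvd_pow_sub_pow y 1 (2 ^ r)
    -- With u = (y-1)h - 1 and y^(2^r) = 1 + (y-1)g, the new (y-1)h must equal 2(1+u)^2 +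
    -- (y-1)g(1+2u), and 1 + u is divisible by y - 1.
    refine ⟨-g + 2 * (y - 1) * g * h + 2 * (y - 1) * h ^ 2, ?_⟩
    rw [pow_succ, pow_mul, pow_mul, hh, sub_eq_iff_eq_add.1 hg]
    ring

/-- Dividing e - 1 instead of e puts K in {1, …, m}, so that e = m k still has J ≤ k - 1; K = 0 is
kept for e = 0. -/
theorem exists_digits {m k e : ℕ} [NeZero k] (he : e ≤ m * k) :
    ∃ (J : Fin k) (K : Fin (m + 1)), e = m * J + K ∧ ((K : ℕ) = 0 → (J : ℕ) = 0) := by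
  rcases Nat.eq_zero_or_pos e with rfl | hpos
  · exact ⟨0, 0, by simp, fun _ => by simp⟩
  · have hm : 0 < m := Nat.pos_of_ne_zero fun h => by simp [h] at he; omega
    have h1 := Nat.mod_lt (e - 1) hm
    have h2 := Nat.div_add_mod (e - 1) m
    have h3 : (e - 1) / m < k := by
      rw [Nat.div_lt_iff_lt_mul hm, mul_comm k]
      omega
    refine ⟨⟨(e - 1) / m, h3⟩, ⟨(e - 1) % m + 1, by omega⟩, ?_, fun h => ?_⟩
    · change e = m * ((e - 1) / m) + ((e - 1) % m + 1)
      omega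
    · exact absurd h (Nat.succ_ne_zero _)

theorem digits_le {m k : ℕ} (J : Fin k) (K : Fin (m + 1)) : m * (J : ℕ) + K ≤ m * k := by
  have h1 : m * ((J : ℕ) + 1) ≤ m * k := Nat.mul_le_mul_left m J.2
  rw [mul_add] at h1
  have := K.2
  omega

theorem digits_unique {m J J' K K' : ℕ} (hK : K ≤ m) (hK' : K' ≤ m) (h : K = 0 → J = 0)
    (h' : K' = 0 → J' = 0) (heq : m * J + K = m * J' + K') : J = J' ∧ K = K' := by
  have aux : ∀ {J J' K K' : ℕ}, K ≤ m → (K' = 0 → J' = 0) → m * J + K = m * J' + K' →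
      ¬ J < J' := by
    intro J J' K K' hK h' heq hlt
    have h1 : m * (J + 1) ≤ m * J' := Nat.mul_le_mul_left m hlt
    rw [mul_add] at h1
    have := h' (by omega)
    omega
  obtain rfl : J = J' :=
    le_antisymm (not_lt.1 (aux hK' h heq.symm)) (not_lt.1 (aux hK h' heq))
  exact ⟨rfl, by omega⟩

/-! ### The lifted factors -/

theorem X_pow_add_one_eq (r n' : ℕ) :
    (X ^ (2 ^ r * n') + 1 : (ZMod 2)[X]) = (X ^ n' - 1) ^ 2 ^ r := by
  rw [CharTwo.sub_eq_add, add_pow_char_pow, one_pow, ← pow_mul, mul_comm]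

theorem two_pow_eq_zero_quotient (k : ℕ) (I : Ideal (ZMod (2 ^ k))[X]) :
    (2 : (ZMod (2 ^ k))[X] ⧸ I) ^ k = 0 := by
  have := congrArg (Ideal.Quotient.mk I) (two_pow_eq_zero k)
  rwa [map_pow, map_ofNat, map_zero] at this

theorem comap_map_mk_span {A : Type*} [CommRing A] {t : A} {I : Ideal A} (h : t ∈ I) :
    (I.map (Ideal.Quotient.mk (Ideal.span {t}))).comap (Ideal.Quotient.mk (Ideal.span {t})) = I := by
  rw [Ideal.comap_map_of_surjective' _ Ideal.Quotient.mk_surjective, Ideal.mk_ker]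
  exact sup_eq_left.2 ((Ideal.span_singleton_le_iff_mem I).2 h)

theorem qTop_mem_idealJK (η : ℕ → F2bar) (k r : ℕ) [NeZero k] {n' : ℕ}
    (J : Lam n' → Fin k) (K : Lam n' → Fin (2 ^ r + 1)) (l : Lam n') :
    qTop η k r l ∈ idealJK η k r J K l := Ideal.subset_span (by simp)


section Lifted

variable (η : ℕ → F2bar) {n' : ℕ}

theorem red_eq (k : ℕ) [NeZero k] : red k = (algebraMap (ZMod 2) F2bar).comp (modTwo k) := rfl

variable (hη : ∀ d, d ∣ n' → IsPrimitiveRoot (η d) d) (hn' : ¬ 2 ∣ n')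

include hη hn'

/-- The cofactor of `q_λ` in `x ^ n' - 1`. -/
theorem exists_isCoprime_qBase_mul_eq (l : Lam n') :
    ∃ c, IsCoprime (qBase η l) c ∧ qBase η l * c = X ^ n' - 1 := by
  classical
  have := Fintype.ofFinite (Lam n')
  refine ⟨∏ m ∈ Finset.univ.erase l, qBase η m, IsCoprime.prod_right fun m hm => ?_, ?_⟩
  · exact qBase_isCoprime η hη hn' (Finset.ne_of_mem_erase hm).symm
  · rw [Finset.mul_prod_erase _ _ (Finset.mem_univ l), prod_qBase η hη hn']

variable (k : ℕ) [NeZero k]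

/-- Hensel lifting supplies the existence that `Classical.epsilon` needs. Only these three
properties are used afterwards, never the uniqueness of the lift. -/
theorem qLift_spec (l : Lam n') :
    (qLift η k l).Monic ∧ qLift η k l ∣ X ^ n' - 1 ∧ (qLift η k l).map (modTwo k) = qBase η l := by
  obtain ⟨c, hc, hqc⟩ := exists_isCoprime_qBase_mul_eq η hη hn' l
  obtain ⟨f, hf, hfd, hfm⟩ := exists_monic_dvd_of_map_eq_mul k (F := X ^ n' - 1)
    (qBase_monic η l) hc (by simp [hqc])
  have h := Classical.epsilon_spec (p := fun f : (ZMod (2 ^ k))[X] =>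
    f.Monic ∧ f ∣ X ^ n' - 1 ∧ f.map (red k) = qRed η l)
    ⟨f, hf, hfd, by rw [red_eq, ← map_map, hfm, map_qBase η hη hn']⟩
  refine ⟨h.1, h.2.1, map_injective _ (algebraMap (ZMod 2) F2bar).injective ?_⟩
  rw [map_qBase η hη hn', map_map]
  exact h.2.2

variable (r : ℕ)

theorem qTop_spec (l : Lam n') :
    (qTop η k r l).Monic ∧ qTop η k r l ∣ X ^ (2 ^ r * n') + 1 ∧
      (qTop η k r l).map (modTwo k) = qBase η l ^ 2 ^ r := by
  obtain ⟨c, hc, hqc⟩ := exists_isCoprime_qBase_mul_eq η hη hn' l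
  obtain ⟨f, hf, hfd, hfm⟩ := exists_monic_dvd_of_map_eq_mul k (F := X ^ (2 ^ r * n') + 1)
    ((qBase_monic η l).pow (2 ^ r)) (hc.pow (m := 2 ^ r) (n := 2 ^ r))
    (by rw [← mul_pow, hqc, ← X_pow_add_one_eq]; simp)
  have h := Classical.epsilon_spec (p := fun f : (ZMod (2 ^ k))[X] =>
    f.Monic ∧ f ∣ X ^ (2 ^ r * n') + 1 ∧ f.map (red k) = qRed η l ^ 2 ^ r)
    ⟨f, hf, hfd, by rw [red_eq, ← map_map, hfm, Polynomial.map_pow, map_qBase η hη hn']⟩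
  refine ⟨h.1, h.2.1, map_injective _ (algebraMap (ZMod 2) F2bar).injective ?_⟩
  rw [Polynomial.map_pow, map_qBase η hη hn', map_map]
  exact h.2.2

theorem qTop_isCoprime : Pairwise fun l m : Lam n' => IsCoprime (qTop η k r l) (qTop η k r m) := by
  intro l m hlm
  apply isCoprime_of_map_modTwo
  rw [(qTop_spec η hη hn' k r l).2.2, (qTop_spec η hη hn' k r m).2.2]
  exact (qBase_isCoprime η hη hn' hlm).pow

theorem prod_qTop [Fintype (Lam n')] : ∏ l : Lam n', qTop η k r l = X ^ (2 ^ r * n') + 1 := by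
  have hn0 : n' ≠ 0 := fun h => hn' (h ▸ dvd_zero 2)
  have hn : 2 ^ r * n' ≠ 0 := mul_ne_zero (by positivity) hn0
  have : Nontrivial (ZMod (2 ^ k)) := ZMod.nontrivial_iff.2 (Nat.one_lt_two_pow (NeZero.ne k)).ne'
  have hm : (∏ l : Lam n', qTop η k r l).Monic :=
    monic_prod_of_monic _ _ fun l _ => (qTop_spec η hη hn' k r l).1
  have hm' : (X ^ (2 ^ r * n') + 1 : (ZMod (2 ^ k))[X]).Monic := by
    simpa using monic_X_pow_add_C (1 : ZMod (2 ^ k)) hn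
  refine (eq_of_monic_of_dvd_of_natDegree_le hm hm' ?_ (le_of_eq ?_)).symm
  · exact Finset.prod_dvd_of_coprime (fun l _ m _ h => qTop_isCoprime η hη hn' k r h)
      fun l _ => (qTop_spec η hη hn' k r l).2.1
  · rw [← hm.natDegree_map (modTwo k), ← hm'.natDegree_map (modTwo k), Polynomial.map_prod]
    simp only [(qTop_spec η hη hn' k r _).2.2, Finset.prod_pow, prod_qBase η hη hn']
    rw [← X_pow_add_one_eq]
    simp

/-! ### The local factors `ℤ/2^k[x]/(q_{λ,r+1})` -/

theorem isUnit_mk_of_isCoprime (l : Lam n') {f : (ZMod (2 ^ k))[X]}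
    (hf : IsCoprime (f.map (modTwo k)) (qBase η l)) :
    IsUnit (Ideal.Quotient.mk (Ideal.span {qTop η k r l}) f) := by
  have h : IsCoprime f (qTop η k r l) := by
    apply isCoprime_of_map_modTwo
    rw [(qTop_spec η hη hn' k r l).2.2]
    exact hf.pow_right
  obtain ⟨a, b, hab⟩ := h
  refine IsUnit.of_mul_eq_one (Ideal.Quotient.mk _ a) ?_
  rw [← map_mul, ← map_one (Ideal.Quotient.mk _), Ideal.Quotient.mk_eq_mk_iff_sub_mem,
    Ideal.mem_span_singleton]
  exact ⟨-b, by linear_combination hab⟩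

/-- Total ramification. In the quotient y = x^n' satisfies y^(2^r) = -1, so (y-1)^(2^r) = 2((y-1)h -
1). Hence y - 1 is nilpotent and the last factor is a unit; moreover y - 1 is `qLift` times a
cofactor which is coprime to q_λ modulo 2, hence a unit. -/
theorem associated_two_mk_qLift_pow (l : Lam n') :
    Associated (2 : (ZMod (2 ^ k))[X] ⧸ Ideal.span {qTop η k r l})
      (Ideal.Quotient.mk (Ideal.span {qTop η k r l}) (qLift η k l) ^ 2 ^ r) := by
  obtain ⟨c, hc, hqc⟩ := exists_isCoprime_qBase_mul_eq η hη hn' l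
  obtain ⟨hQ, ⟨d, hd⟩, hQm⟩ := qLift_spec η hη hn' k l
  obtain ⟨hT, hTd, hTm⟩ := qTop_spec η hη hn' k r l
  have hdm : d.map (modTwo k) = c := by
    have := congrArg (Polynomial.map (modTwo k)) hd
    rw [Polynomial.map_mul, hQm] at this
    refine mul_left_cancel₀ (qBase_monic η l).ne_zero ?_
    rw [← this, hqc]
    simp
  have hu : IsUnit (Ideal.Quotient.mk (Ideal.span {qTop η k r l}) d) :=
    isUnit_mk_of_isCoprime η hη hn' k r l (hdm ▸ hc.symm)
  set p := Ideal.Quotient.mk (Ideal.span {qTop η k r l}) with hp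
  obtain ⟨h, hh⟩ := exists_sub_one_pow_two_pow_eq (p (X ^ n')) r
  have h0 : p (X ^ n') ^ 2 ^ r + 1 = 0 := by
    rw [← map_pow, ← pow_mul, mul_comm n', ← map_one p, ← map_add, hp,
      Ideal.Quotient.eq_zero_iff_mem, Ideal.mem_span_singleton]
    exact hTd
  rw [h0, zero_add] at hh
  have hw : IsUnit ((p (X ^ n') - 1) * h - 1) := by
    have hnil : IsNilpotent (p (X ^ n') - 1) := ⟨2 ^ r * k, by
      rw [pow_mul, hh, mul_pow, two_pow_eq_zero_quotient, zero_mul]⟩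
    exact (Commute.isNilpotent_mul_right (Commute.all _ _) hnil).isUnit_sub_one
  have hz : p (X ^ n') - 1 = p (qLift η k l) * p d := by rw [← map_mul, ← hd, map_sub, map_one]
  rw [hz, mul_pow, ← hz] at hh
  have e1 : Associated (2 * ((p (X ^ n') - 1) * h - 1)) 2 := associated_mul_unit_left _ _ hw
  have e2 : Associated (p (qLift η k l) ^ 2 ^ r * p d ^ 2 ^ r) (p (qLift η k l) ^ 2 ^ r) :=
    associated_mul_unit_left _ _ (hu.pow _)
  rw [hh] at e2
  exact e1.symm.trans e2

/-- Modulo 2, f is either divisible by the irreducible q_λ or coprime to it; the error in lifting a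
divisibility is a multiple of 2, hence of π. -/
theorem mk_qLift_dvd_or_isUnit (l : Lam n')
    (a : (ZMod (2 ^ k))[X] ⧸ Ideal.span {qTop η k r l}) :
    Ideal.Quotient.mk (Ideal.span {qTop η k r l}) (qLift η k l) ∣ a ∨ IsUnit a := by
  obtain ⟨f, rfl⟩ := Ideal.Quotient.mk_surjective a
  rcases dvd_or_isCoprime _ (f.map (modTwo k)) (qBase_irreducible η l) with ⟨g', hg⟩ | h
  · left
    obtain ⟨g, rfl⟩ := modTwo_map_surjective k g'
    obtain ⟨c, hc⟩ : 2 ∣ f - qLift η k l * g := two_dvd_of_map_eq_zero k (by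
      rw [Polynomial.map_sub, Polynomial.map_mul, (qLift_spec η hη hn' k l).2.2, hg, sub_self])
    rw [sub_eq_iff_eq_add.1 hc, map_add, map_mul, map_mul, map_ofNat]
    refine dvd_add (Dvd.dvd.mul_right ?_ _) (dvd_mul_right _ _)
    exact (dvd_pow_self _ (by positivity)).trans
      (associated_two_mk_qLift_pow η hη hn' k r l).symm.dvd
  · exact Or.inr (isUnit_mk_of_isCoprime η hη hn' k r l h.symm)

theorem associated_two_pow_mk_qLift_pow (l : Lam n') (j : ℕ) :
    Associated (2 ^ j : (ZMod (2 ^ k))[X] ⧸ Ideal.span {qTop η k r l})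
      (Ideal.Quotient.mk (Ideal.span {qTop η k r l}) (qLift η k l) ^ (2 ^ r * j)) := by
  rw [pow_mul]
  exact (associated_two_mk_qLift_pow η hη hn' k r l).pow_pow

theorem mk_qLift_pow_eq_zero (l : Lam n') :
    Ideal.Quotient.mk (Ideal.span {qTop η k r l}) (qLift η k l) ^ (2 ^ r * k) = 0 := by
  have := associated_two_pow_mk_qLift_pow η hη hn' k r l k
  rwa [two_pow_eq_zero_quotient, Associated.comm, associated_zero_iff_eq_zero] at this

theorem mk_qLift_pow_ne_zero (l : Lam n') {e : ℕ} (he : e < 2 ^ r * k) :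
    Ideal.Quotient.mk (Ideal.span {qTop η k r l}) (qLift η k l) ^ e ≠ 0 := by
  intro h0
  have : Nontrivial (ZMod (2 ^ k)) := ZMod.nontrivial_iff.2 (Nat.one_lt_two_pow (NeZero.ne k)).ne'
  obtain ⟨hQ, -, hQm⟩ := qLift_spec η hη hn' k l
  obtain ⟨hT, -, hTm⟩ := qTop_spec η hη hn' k r l
  have hr : 0 < 2 ^ r := by positivity
  obtain ⟨j, hj⟩ : ∃ j, k = j + 1 := Nat.exists_eq_succ_of_ne_zero (NeZero.ne k)
  -- It suffices to treat the largest exponent 2^r k - 1. That power is associated to 2^(k-1) q^(2^r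
  -- - 1), a nonzero polynomial of degree below that of the monic `qTop`.
  have h1 : Ideal.Quotient.mk (Ideal.span {qTop η k r l}) (qLift η k l) ^
      (2 ^ r * j + (2 ^ r - 1)) = 0 := by
    refine pow_eq_zero_of_le ?_ h0
    rw [hj, mul_add] at he
    omega
  have h2 : Ideal.Quotient.mk (Ideal.span {qTop η k r l})
      (C (2 ^ j) * qLift η k l ^ (2 ^ r - 1)) = 0 := by
    have := (associated_two_pow_mk_qLift_pow η hη hn' k r l j).mul_right
      (Ideal.Quotient.mk (Ideal.span {qTop η k r l}) (qLift η k l) ^ (2 ^ r - 1))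
    rw [← pow_add, h1, associated_zero_iff_eq_zero] at this
    rw [C_pow, map_mul, map_pow, map_pow, ← this, C_ofNat, map_ofNat]
  rw [Ideal.Quotient.eq_zero_iff_mem, Ideal.mem_span_singleton] at h2
  have h2j : (2 ^ j : ZMod (2 ^ k)) ≠ 0 := by
    have : ((2 ^ j : ℕ) : ZMod (2 ^ k)) ≠ 0 := by
      rw [Ne, ZMod.natCast_eq_zero_iff, Nat.pow_dvd_pow_iff_le_right (by norm_num)]
      omega
    exact_mod_cast this
  refine hT.not_dvd_of_natDegree_lt ?_ ?_ h2
  · intro h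
    have := congrArg (fun p => p.coeff (qLift η k l ^ (2 ^ r - 1)).natDegree) h
    simp only [coeff_C_mul, coeff_zero, (hQ.pow (2 ^ r - 1)).coeff_natDegree, mul_one] at this
    exact h2j this
  · refine (natDegree_C_mul_le _ _).trans_lt ?_
    rw [hQ.natDegree_pow, ← hQ.natDegree_map (modTwo k), ← hT.natDegree_map (modTwo k), hQm, hTm,
      (qBase_monic η l).natDegree_pow]
    exact Nat.mul_lt_mul_of_pos_right (by omega) (qBase_irreducible η l).natDegree_pos

/-- The ideals of `ℤ/2^k[x]` containing `q_{λ,r+1}`. -/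
noncomputable def chainIdeal (l : Lam n') (e : ℕ) : Ideal (ZMod (2 ^ k))[X] :=
  (Ideal.span {Ideal.Quotient.mk (Ideal.span {qTop η k r l}) (qLift η k l) ^ e}).comap
    (Ideal.Quotient.mk (Ideal.span {qTop η k r l}))

theorem exists_eq_chainIdeal (l : Lam n') {I : Ideal (ZMod (2 ^ k))[X]} (hI : qTop η k r l ∈ I) :
    ∃ e ≤ 2 ^ r * k, I = chainIdeal η k r l e := by
  obtain ⟨e, he, h⟩ := exists_eq_span_pow (mk_qLift_dvd_or_isUnit η hη hn' k r l)
    (mk_qLift_pow_eq_zero η hη hn' k r l) (I.map (Ideal.Quotient.mk (Ideal.span {qTop η k r l})))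
  exact ⟨e, he, by rw [chainIdeal, ← h, comap_map_mk_span hI]⟩

theorem chainIdeal_injective (l : Lam n') {d e : ℕ} (hd : d ≤ 2 ^ r * k) (he : e ≤ 2 ^ r * k)
    (h : chainIdeal η k r l d = chainIdeal η k r l e) : d = e :=
  span_pow_injective (mk_qLift_pow_eq_zero η hη hn' k r l)
    (fun _ h => mk_qLift_pow_ne_zero η hη hn' k r l h) hd he
    (Ideal.comap_injective_of_surjective _ Ideal.Quotient.mk_surjective h)

theorem two_pow_mem_chainIdeal (l : Lam n') {e j : ℕ} (he : e ≤ 2 ^ r * j) :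
    2 ^ j ∈ chainIdeal η k r l e := by
  rw [chainIdeal, Ideal.mem_comap, Ideal.mem_span_singleton, map_pow, map_ofNat]
  exact (pow_dvd_pow _ he).trans (associated_two_pow_mk_qLift_pow η hη hn' k r l j).symm.dvd

/-- The generators become 0, a unit times π^(2^r J + K), and a unit times π^(2^r (J+1)); the last is
redundant because K ≤ 2^r. -/
theorem idealJK_eq_chainIdeal (J : Lam n' → Fin k) (K : Lam n' → Fin (2 ^ r + 1)) (l : Lam n') :
    idealJK η k r J K l = chainIdeal η k r l (2 ^ r * J l + K l) := by
  rw [← comap_map_mk_span (qTop_mem_idealJK η k r J K l), chainIdeal, idealJK,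
    Ideal.map_span]
  congr 1
  have h2 := fun j => associated_two_pow_mk_qLift_pow η hη hn' k r l j
  have hK : (K l : ℕ) ≤ 2 ^ r := Nat.lt_succ_iff.1 (K l).2
  have h3 := (h2 (J l)).mul_right
    (Ideal.Quotient.mk (Ideal.span {qTop η k r l}) (qLift η k l) ^ (K l : ℕ))
  rw [← pow_add] at h3
  refine le_antisymm (Ideal.span_le.2 ?_) ?_
  · rintro _ ⟨f, rfl | rfl | rfl, rfl⟩
    · rw [Ideal.Quotient.eq_zero_iff_mem.2 (Ideal.mem_span_singleton_self _)]
      exact Ideal.zero_mem _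
    · rw [SetLike.mem_coe, Ideal.mem_span_singleton, map_mul, map_pow, map_pow, map_ofNat]
      exact h3.symm.dvd
    · rw [SetLike.mem_coe, Ideal.mem_span_singleton, map_pow, map_ofNat]
      refine (pow_dvd_pow _ ?_).trans (h2 _).symm.dvd
      rw [mul_add]
      omega
  · rw [Ideal.span_singleton_le_iff_mem]
    refine Ideal.mem_of_dvd _ h3.dvd (Ideal.subset_span ⟨_, Or.inr (Or.inl rfl), ?_⟩)
    rw [map_mul, map_pow, map_pow, map_ofNat]

/-! ### Classification of the ideals containing `x ^ n + 1` -/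

theorem iInf_idealJK_injective {J J' : Lam n' → Fin k} {K K' : Lam n' → Fin (2 ^ r + 1)}
    (h : ∀ l, (K l : ℕ) = 0 → (J l : ℕ) = 0) (h' : ∀ l, (K' l : ℕ) = 0 → (J' l : ℕ) = 0)
    (heq : ⨅ l, idealJK η k r J K l = ⨅ l, idealJK η k r J' K' l) : J = J' ∧ K = K' := by
  have := Fintype.ofFinite (Lam n')
  have key : ∀ l, (J l : ℕ) = J' l ∧ (K l : ℕ) = K' l := by
    intro l
    have h1 := iInf_sup_span_eq (qTop_isCoprime η hη hn' k r) (qTop_mem_idealJK η k r J K) l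
    have h2 := iInf_sup_span_eq (qTop_isCoprime η hη hn' k r) (qTop_mem_idealJK η k r J' K') l
    rw [heq, h2, idealJK_eq_chainIdeal η hη hn', idealJK_eq_chainIdeal η hη hn'] at h1
    refine digits_unique (Nat.lt_succ_iff.1 (K l).2) (Nat.lt_succ_iff.1 (K' l).2) (h l) (h' l) ?_
    exact (chainIdeal_injective η hη hn' k r l (digits_le _ _) (digits_le _ _) h1).symm
  exact ⟨funext fun l => Fin.ext (key l).1, funext fun l => Fin.ext (key l).2⟩

theorem exists_eq_iInf_idealJK {I : Ideal (ZMod (2 ^ k))[X]}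
    (hI : X ^ (2 ^ r * n') + 1 ∈ I) (hI' : 2 ^ (k - 1) ∉ I) :
    ∃ (J : Lam n' → Fin k) (K : Lam n' → Fin (2 ^ r + 1)),
      IsAdmissible J K ∧ I = ⨅ l, idealJK η k r J K l := by
  have := Fintype.ofFinite (Lam n')
  have hJK : ∀ l : Lam n', ∃ (J : Fin k) (K : Fin (2 ^ r + 1)), ((K : ℕ) = 0 → (J : ℕ) = 0) ∧
      I ⊔ Ideal.span {qTop η k r l} = chainIdeal η k r l (2 ^ r * J + K) := by
    intro l
    obtain ⟨e, he, h⟩ := exists_eq_chainIdeal η hη hn' k r l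
      (I := I ⊔ Ideal.span {qTop η k r l})
      (Ideal.mem_sup_right (Ideal.mem_span_singleton_self _))
    obtain ⟨J, K, rfl, h0⟩ := exists_digits he
    exact ⟨J, K, h0, h⟩
  choose J K h0 h using hJK
  have heq : I = ⨅ l, idealJK η k r J K l := by
    refine le_antisymm (le_iInf fun l => ?_) fun f hf => ?_
    · rw [idealJK_eq_chainIdeal η hη hn', ← h]
      exact le_sup_left
    · refine mem_of_forall_mem_sup_span (qTop_isCoprime η hη hn' k r)
        (by rwa [prod_qTop η hη hn']) fun l => ?_
      rw [h, ← idealJK_eq_chainIdeal η hη hn']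
      exact Ideal.mem_iInf.1 hf l
  refine ⟨J, K, ⟨?_, h0⟩, heq⟩
  obtain ⟨l, hl⟩ : ∃ l, 2 ^ (k - 1) ∉ idealJK η k r J K l := by
    by_contra! hall
    rw [heq] at hI'
    exact hI' (Ideal.mem_iInf.2 hall)
  rw [idealJK_eq_chainIdeal η hη hn'] at hl
  -- As 2^(k-1) generates the same ideal as π^(2^r (k-1)), the exponent at l is larger than 2^r
  -- (k-1). With K ≤ 2^r this gives J = k - 1, and K = 0 would make the exponent 0.
  have hlt : 2 ^ r * (k - 1) < 2 ^ r * (J l : ℕ) + K l := by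
    by_contra! hle
    exact hl (two_pow_mem_chainIdeal η hη hn' k r l hle)
  have hK : (K l : ℕ) ≤ 2 ^ r := Nat.lt_succ_iff.1 (K l).2
  have hJ := (J l).2
  have h3 : k - 1 < (J l : ℕ) + 1 := by
    refine Nat.lt_of_mul_lt_mul_left (a := 2 ^ r) ?_
    rw [mul_add]
    omega
  refine ⟨l, by omega, fun hK0 => ?_⟩
  rw [h0 l hK0, hK0] at hlt
  omega

end Lifted

/-! ### The module structure given by the rotation -/

section Module

/-- The annihilator of `g` under the action of polynomials in the endomorphism `a`. -/
noncomputable def polyAnnihilator {R G : Type*} [CommRing R] [AddCommGroup G] [Module R G]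
    (a : Module.End R G) (g : G) : Ideal R[X] where
  carrier := {p | aeval a p g = 0}
  zero_mem' := by simp
  add_mem' {p q} hp hq := by
    have hp : aeval a p g = 0 := hp
    have hq : aeval a q g = 0 := hq
    simp [hp, hq]
  smul_mem' c p hp := by
    have hp : aeval a p g = 0 := hp
    simp [hp]

theorem mem_polyAnnihilator {R G : Type*} [CommRing R] [AddCommGroup G] [Module R G]
    {a : Module.End R G} {g : G} {p : R[X]} : p ∈ polyAnnihilator a g ↔ aeval a p g = 0 := Iff.rfl

/-- An additive map intertwining `a` with multiplication by `x` is linear over the polynomials. -/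
theorem map_aeval_zmod {m : ℕ} [NeZero m] {G H : Type*} [AddCommGroup G] [Module (ZMod m) G]
    [AddCommGroup H] [Module (ZMod m)[X] H] {a : Module.End (ZMod m) G} {h : G →+ H}
    (hX : ∀ g, h (a g) = (X : (ZMod m)[X]) • h g) (p : (ZMod m)[X]) (g : G) :
    h (aeval a p g) = p • h g := by
  induction p using Polynomial.induction_on generalizing g with
  | C c =>
    obtain ⟨j, rfl⟩ := ZMod.natCast_zmod_surjective c
    rw [map_natCast, map_natCast, Nat.cast_smul_eq_nsmul, ← map_nsmul]
    rfl
  | add p q hp hq => rw [map_add, LinearMap.add_apply, map_add, hp, hq, add_smul]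
  | monomial n c ih =>
    rw [pow_succ, ← mul_assoc, map_mul, aeval_X, Module.End.mul_apply, ih, hX, mul_smul (C c * X ^ n) X]

theorem exists_addEquiv_of_ker_eq {A G H : Type*} [AddCommGroup A] [AddCommGroup G]
    [AddCommGroup H] {f : A →+ G} {g : A →+ H} (hf : Function.Surjective f)
    (hg : Function.Surjective g) (h : f.ker = g.ker) : ∃ θ : G ≃+ H, ∀ p, θ (f p) = g p := by
  refine ⟨(QuotientAddGroup.quotientKerEquivOfSurjective f hf).symm.trans
    ((QuotientAddGroup.quotientAddEquivOfEq h).trans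
      (QuotientAddGroup.quotientKerEquivOfSurjective g hg)), fun p => ?_⟩
  have : (QuotientAddGroup.quotientKerEquivOfSurjective f hf).symm (f p) = (p : A ⧸ f.ker) := by
    rw [AddEquiv.symm_apply_eq]
    rfl
  rw [AddEquiv.trans_apply, this]
  rfl

end Module

namespace CayleyData

variable {G : Type*} [AddCommGroup G] {m : ℕ} [Module (ZMod m) G] {M : CayleyData G}

theorem pow_apply_eq_iterate (hM : M.IsCayleyMap) {a : Module.End (ZMod m) G}
    (ha : ∀ w ∈ M.Ω, a w = M.ρ w) {w : G} (hw : w ∈ M.Ω) (j : ℕ) : (a ^ j) w = M.ρ^[j] w := by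
  induction j with
  | zero => rfl
  | succ j ih =>
    rw [pow_succ', Module.End.mul_apply, ih, ha _ (hM.iterate_mem j hw),
      Function.iterate_succ_apply']

/-- Every element of the connection set generates the group over the polynomials. -/
theorem aeval_surjective (hM : M.IsCayleyMap) {a : Module.End (ZMod m) G}
    (ha : ∀ w ∈ M.Ω, a w = M.ρ w) {w : G} (hw : w ∈ M.Ω) (g : G) :
    ∃ p : (ZMod m)[X], aeval a p w = g := by
  have hg : g ∈ AddSubgroup.closure M.Ω := by rw [hM.generates]; trivial
  induction hg using AddSubgroup.closure_induction with
  | mem b hb =>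
    obtain ⟨j, rfl⟩ := hM.cyclic w hw b hb
    exact ⟨X ^ j, by rw [aeval_X_pow, pow_apply_eq_iterate hM ha hw]⟩
  | zero => exact ⟨0, by simp⟩
  | add x y _ _ hx hy =>
    obtain ⟨p, rfl⟩ := hx
    obtain ⟨q, rfl⟩ := hy
    exact ⟨p + q, by simp⟩
  | neg x _ hx =>
    obtain ⟨p, rfl⟩ := hx
    exact ⟨-p, by simp⟩

end CayleyData

/-! ### The rotation of `CM(G_{J,K}, Ω_{J,K}, ρ_{J,K})` -/

section Target

variable (η : ℕ → F2bar) (k r : ℕ) [NeZero k] {n' : ℕ}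
  (J : Lam n' → Fin k) (K : Lam n' → Fin (2 ^ r + 1))

/-- The quotient map onto `G_{J,K}`. -/
noncomputable def toGJK : (ZMod (2 ^ k))[X] →+* GJK η k r J K :=
  RingHom.pi fun l => Ideal.Quotient.mk (idealJK η k r J K l)

theorem toGJK_eq_zero_iff (p : (ZMod (2 ^ k))[X]) :
    toGJK η k r J K p = 0 ↔ p ∈ ⨅ l, idealJK η k r J K l := by
  rw [Ideal.mem_iInf, funext_iff]
  exact forall_congr' fun l => Ideal.Quotient.eq_zero_iff_mem

theorem omegaJK_eq_toGJK (i : ℕ) : omegaJK η k r J K i = toGJK η k r J K (X ^ i) := rfl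

theorem mapJK_iterate (j : ℕ) (g : GJK η k r J K) :
    (mapJK η k r J K).ρ^[j] g = omegaJK η k r J K j * g := by
  induction j with
  | zero => rw [omegaJK_eq_toGJK, pow_zero, map_one, one_mul]; rfl
  | succ j ih =>
    rw [Function.iterate_succ_apply', ih]
    change omegaJK η k r J K 1 * _ = _
    rw [omegaJK_eq_toGJK, omegaJK_eq_toGJK, omegaJK_eq_toGJK, ← mul_assoc, ← map_mul, pow_one,
      ← pow_succ']

variable (hη : ∀ d, d ∣ n' → IsPrimitiveRoot (η d) d) (hn' : ¬ 2 ∣ n')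

include hη hn'

theorem omegaJK_eq_neg_one : omegaJK η k r J K (2 ^ r * n') = -1 := by
  rw [omegaJK_eq_toGJK, eq_neg_iff_add_eq_zero, ← map_one (toGJK η k r J K), ← map_add,
    toGJK_eq_zero_iff, Ideal.mem_iInf]
  exact fun l => Ideal.mem_of_dvd _ (qTop_spec η hη hn' k r l).2.1 (qTop_mem_idealJK η k r J K l)

theorem mapJK_iterate_eq_neg (g : GJK η k r J K) :
    (mapJK η k r J K).ρ^[2 ^ r * n'] g = -g := by
  rw [mapJK_iterate, omegaJK_eq_neg_one η k r J K hη hn']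
  exact neg_one_mul g

/-- An isomorphism need not send the chosen generator to 1, only into Ω. Since x^i x^(n-i) = -1, its
image is a unit, and units all have the same annihilator. -/
theorem isUnit_of_mem_mapJK {v : GJK η k r J K} (hv : v ∈ (mapJK η k r J K).Ω) : IsUnit v := by
  obtain ⟨i, hi, h⟩ := hv
  have hu : IsUnit (omegaJK η k r J K i) := by
    refine IsUnit.of_mul_eq_one (-omegaJK η k r J K (2 ^ r * n' - i)) ?_
    have h1 : omegaJK η k r J K i * omegaJK η k r J K (2 ^ r * n' - i) =
        omegaJK η k r J K (2 ^ r * n') := by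
      rw [omegaJK_eq_toGJK, omegaJK_eq_toGJK, omegaJK_eq_toGJK, ← map_mul, ← pow_add,
        Nat.add_sub_cancel' hi.le]
    refine (mul_neg (omegaJK η k r J K i) (omegaJK η k r J K (2 ^ r * n' - i))).trans ?_
    rw [h1, omegaJK_eq_neg_one η k r J K hη hn']
    exact neg_neg 1
  rcases h with rfl | rfl
  · exact hu
  · exact hu.neg

theorem toGJK_surjective : Function.Surjective (toGJK η k r J K) := by
  have := Fintype.ofFinite (Lam n')
  exact pi_mk_surjective (qTop_isCoprime η hη hn' k r) (qTop_mem_idealJK η k r J K)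

/-- The ideal `⋂ I_λ` can be recovered from a map isomorphic to `CM(G_{J,K}, Ω_{J,K}, ρ_{J,K})`. -/
theorem polyAnnihilator_eq_of_iso {G : Type*} [AddCommGroup G] [Module (ZMod (2 ^ k)) G]
    {M : CayleyData G} (hM : M.IsCayleyMap) (hneg : ∀ b ∈ M.Ω, M.ρ^[2 ^ r * n'] b = -b)
    {a : Module.End (ZMod (2 ^ k)) G} (ha : ∀ w ∈ M.Ω, a w = M.ρ w) {w : G} (hw : w ∈ M.Ω)
    (φ : CayleyData.Iso M (mapJK η k r J K)) :
    polyAnnihilator a w = ⨅ l, idealJK η k r J K l := by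
  have hneg' : ∀ b ∈ (mapJK η k r J K).Ω, (mapJK η k r J K).ρ^[2 ^ r * n'] b = -b :=
    fun b _ => mapJK_iterate_eq_neg η k r J K hη hn' b
  let h := φ.toAddMonoidHom hM hneg hneg'
  let _ : Module (ZMod (2 ^ k))[X] (GJK η k r J K) := Module.compHom _ (toGJK η k r J K)
  have hsmul : ∀ (p : (ZMod (2 ^ k))[X]) (y : GJK η k r J K), p • y = toGJK η k r J K p * y :=
    fun _ _ => rfl
  have hX : ∀ g, h (a g) = (X : (ZMod (2 ^ k))[X]) • h g := by
    intro g
    have hg : g ∈ AddSubgroup.closure M.Ω := by rw [hM.generates]; trivial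
    induction hg using AddSubgroup.closure_induction with
    | mem b hb =>
      rw [ha b hb, φ.toAddMonoidHom_rot hM hneg hneg' hb, hsmul, ← pow_one X, ← omegaJK_eq_toGJK]
      rfl
    | zero => simp
    | add x y _ _ hx hy => rw [map_add, map_add, map_add, hx, hy, smul_add]
    | neg x _ hx => rw [map_neg, map_neg, map_neg, hx, smul_neg]
  have hv : IsUnit (h w) :=
    isUnit_of_mem_mapJK η k r J K hη hn' (φ.toAddMonoidHom_mem hM hneg hneg' hw)
  ext p
  rw [mem_polyAnnihilator, ← toGJK_eq_zero_iff,
    ← map_eq_zero_iff h (φ.toAddMonoidHom_injective hM hneg hneg'), map_aeval_zmod hX]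
  exact hv.mul_left_eq_zero

end Target

/-! ### The classification theorem -/

theorem mainTheorem3
    (n r n' k : ℕ) [NeZero k] (hn : n = 2 ^ r * n') (hn' : ¬ 2 ∣ n')
    (η : ℕ → F2bar) (hη : ∀ d, d ∣ n' → IsPrimitiveRoot (η d) d)
    {G : Type*} [AddCommGroup G] [Finite G] (hG : AddMonoid.exponent G = 2 ^ k)
    (M : CayleyData G) (hM : M.IsTypeIRBCM n) :
    ∃ (J : Lam n' → Fin k) (K : Lam n' → Fin (2 ^ r + 1)),
      IsAdmissible J K ∧
      (mapJK η k r J K).IsCayleyMap ∧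
      (mapJK η k r J K).IsTypeIWith n (omegaJK η k r J K) ∧
      Nonempty (CayleyData.Iso M (mapJK η k r J K)) ∧
      ∀ (J' : Lam n' → Fin k) (K' : Lam n' → Fin (2 ^ r + 1)),
        IsAdmissible J' K' →
        Nonempty (CayleyData.Iso M (mapJK η k r J' K')) →
        J' = J ∧ K' = K := by
  subst hn
  have hn0 : 0 < 2 ^ r * n' :=
    Nat.mul_pos (by positivity) (Nat.pos_of_ne_zero fun h => hn' (h ▸ dvd_zero 2))
  have hC := hM.isCayleyMap
  obtain ⟨α, hα⟩ := hM.exists_addMonoidHom hn0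
  obtain ⟨ω, hω⟩ := hM.typeI
  have hneg : ∀ b ∈ M.Ω, M.ρ^[2 ^ r * n'] b = -b :=
    fun b hb => hω.iterate_eq_neg hn0 hC hM.balanced hb
  have h0 := hω.mem hn0
  have : Module (ZMod (2 ^ k)) G := AddCommGroup.zmodModule fun x => by
    rw [← hG]; exact AddMonoid.exponent_nsmul_eq_zero x
  obtain ⟨a, ha⟩ : ∃ a : Module.End (ZMod (2 ^ k)) G, ∀ w ∈ M.Ω, a w = M.ρ w :=
    ⟨α.toZModLinearMap (2 ^ k), hα⟩
  have hsurj := CayleyData.aeval_surjective hC ha h0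
  obtain ⟨J, K, hJK, hI⟩ := exists_eq_iInf_idealJK η hη hn' k r (I := polyAnnihilator a (ω 0))
    (by
      rw [mem_polyAnnihilator, map_add, aeval_X_pow, map_one, LinearMap.add_apply, Module.End.one_apply,
        CayleyData.pow_apply_eq_iterate hC ha h0, hneg _ h0, neg_add_cancel])
    (by
      intro h
      rw [mem_polyAnnihilator] at h
      have h2 : (2 ^ (k - 1)) • ω 0 = 0 := by
        have h3 : (2 ^ (k - 1) : (ZMod (2 ^ k))[X]) = ((2 ^ (k - 1) : ℕ) : (ZMod (2 ^ k))[X]) := by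
          push_cast; rfl
        rwa [h3, map_natCast, Module.End.natCast_apply] at h
      -- Multiples of ω 0 by polynomials in a fill G, so an integer killing ω 0 kills G.
      have hd : AddMonoid.exponent G ∣ 2 ^ (k - 1) :=
        AddMonoid.exponent_dvd_of_forall_nsmul_eq_zero fun g => by
          obtain ⟨p, rfl⟩ := hsurj g
          rw [← map_nsmul, h2, map_zero]
      rw [hG, Nat.pow_dvd_pow_iff_le_right (by norm_num)] at hd
      have := NeZero.pos k
      omega)
  -- Both G and G_{J,K} are quotients of the polynomial ring by the same ideal, which identifies x^i
  -- ω 0 with the class of x^i.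
  let ψ : (ZMod (2 ^ k))[X] →+ G :=
    { toFun := fun p => aeval a p (ω 0), map_zero' := by simp, map_add' := by simp }
  obtain ⟨θ, hθ⟩ := exists_addEquiv_of_ker_eq (f := ψ) (g := (toGJK η k r J K).toAddMonoidHom)
    hsurj (toGJK_surjective η k r J K hη hn') (by
      ext p
      change p ∈ polyAnnihilator a (ω 0) ↔ toGJK η k r J K p = 0
      rw [hI, toGJK_eq_zero_iff])
  have hθω : ∀ i < 2 ^ r * n', omegaJK η k r J K i = θ (ω i) := by
    intro i hi
    have h1 : aeval a (X ^ i : (ZMod (2 ^ k))[X]) (ω 0) = ω i := by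
      rw [aeval_X_pow, CayleyData.pow_apply_eq_iterate hC ha h0, hω.iterate_zero hi]
    rw [omegaJK_eq_toGJK, ← h1]
    exact (hθ _).symm
  have hΩ : (mapJK η k r J K).Ω = θ '' M.Ω := by
    rw [hω.set_eq]
    ext y
    constructor
    · rintro ⟨i, hi, rfl | rfl⟩
      · exact ⟨_, ⟨i, hi, Or.inl rfl⟩, (hθω i hi).symm⟩
      · exact ⟨_, ⟨i, hi, Or.inr rfl⟩, by rw [map_neg, hθω i hi]⟩
    · rintro ⟨_, ⟨i, hi, rfl | rfl⟩, rfl⟩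
      · exact ⟨i, hi, Or.inl (hθω i hi).symm⟩
      · exact ⟨i, hi, Or.inr (by rw [map_neg, hθω i hi])⟩
  have hρ : ∀ b ∈ M.Ω, (mapJK η k r J K).ρ (θ b) = θ (M.ρ b) := by
    intro b hb
    obtain ⟨p, rfl⟩ := hsurj b
    have h1 : θ (aeval a p (ω 0)) = toGJK η k r J K p := hθ p
    have h2 : θ (aeval a (X * p) (ω 0)) = toGJK η k r J K (X * p) := hθ (X * p)
    rw [← ha _ hb, h1]
    rw [map_mul, aeval_X, Module.End.mul_apply] at h2
    rw [h2, map_mul, ← pow_one X]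
    rfl
  -- That the target is a Cayley map of valency 2n is inherited from M through θ; in particular 0 ∉
  -- Ω and the distinctness of the ±x^i need no computation with polynomials.
  refine ⟨J, K, hJK, hC.transport θ hΩ hρ, hω.transport θ hΩ hρ hn0 hC hθω,
    ⟨CayleyData.isoOfAddEquiv θ hΩ hρ⟩, ?_⟩
  rintro J' K' hJK' ⟨φ⟩
  refine iInf_idealJK_injective η hη hn' k r hJK'.normalized hJK.normalized ?_
  rw [← hI, polyAnnihilator_eq_of_iso η k r J' K' hη hn' hC hneg ha h0 φ]
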